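/- **Notation.** Let $K$ be a number field of degree $n$. For a prime ideal $\mathfrak p$ of local degree $n_{\mathfrak p}=e_{\mathfrak p}f_{\mathfrak p}$ put $|x|_{\mathfrak p}=\mathrm{N}\mathfrak p^{-\mathrm{ord}_{\mathfrak p}(x)/n_{\mathfrak p}}$; for an archimedean place given by $\sigma:K\hookrightarrow\mathbf C$ put $|x|_\sigma=|\sigma(x)|$ and $n_\sigma=1$ or $2$ according to whether $\sigma$ is real or complex. Let $K_v$ be the completion at $v$; the absolute value of a tuple is the maximum over its entries. If $v\nmid\infty$, then $O_v^{m+1}=\{z\in K_v^{m+1}:|z|_v\le 1\}$ and $\mu_v$ is the Haar measure on $K_v^{m+1}$ with $\mu_v(O_v^{m+1})=1$; if $v\mid\infty$, then $\mu_v$ is Lebesgue measure on $K_v^{m+1}\cong\mathbf R^{n_v(m+1)}$. For $m\ge 1$ let $$c_K(m)=\frac{hR(m+1)^r}{w\,\zeta_K(m+1)}\Big(\frac{2^{r_2}}{\sqrt{d_K}}\Big)^{m+1},$$ with $h$ the class number, $R$ the regulator, $r$ the unit rank, $w$ the number of roots of unity, $\zeta_K$ the Dedekind zeta function, $r_2$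 the number of complex places and $d_K$ the absolute value of the discriminant. A morphism $\varphi:\mathbf P^m\to\mathbf P^M$ of degree $k$ defined over $K$ is given by a lift $\Phi=(\Phi_0,\dots,\Phi_M)$, a tuple of forms of degree $k$ over $K$ in $m+1$ variables without nontrivial common zero over $\overline K$; lifts are unique up to a nonzero scalar. Let $|\Phi|_v$ be the maximum of the $|\cdot|_v$ of all coefficients of $\Phi$ and $H(\varphi)=\prod_v|\Phi|_v^{n_v/n}$. For $k\ge1$ put $$c_{K,v}(\varphi)=\begin{cases}\mu_v\{z\in K_v^{m+1}:|\Phi(z)|_v\le|\Phi|_v\}& v\mid\infty\\[1ex] \displaystyle\int_{O_v^{m+1}}\bigg(\frac{|z|_v|\Phi|_v^{1/k}}{|\Phi(z)|_v^{1/k}}\bigg)^{n_v(m+1)}d\mu_v(z)& v\nmid\infty\end{cases}$$ and $c_K(\varphi)=c_K(m)\,H(\varphi)^{-n(m+1)/k}\prod_v c_{K,v}(\varphi)$. **Statement.** Let $m\ge1$, let $f:\mathbf P^M\to\mathbf P^M$ be a morphism of degree $d\ge2$ and $g:\mathbf P^m\to\mathbf P^M$ a morphism of degree $e\ge1$, both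 defined over $K$, with lifts $F$ and $G$. For every place $v$ of $K$ the limits $$\mathcal G_{F,v}(x)=\lim_{i\to\infty}\frac{\log|F^i(x)|_v}{d^i}\quad(x\in K_v^{M+1}\setminus\{0\}),\qquad |\hat F\circ G|_v=\lim_{i\to\infty}|F^i\circ G|_v^{1/d^i}$$ exist. The limit $\hat c_{K,f}(g):=\lim_{i\to\infty}c_K(f^i\circ g)$ exists, and $$\hat c_{K,f}(g)=c_K(m)\prod_{v\mid\infty}\mu_v\{z\in K_v^{m+1}:\mathcal G_{F,v}(G(z))\le0\}\prod_{v\nmid\infty}\int_{O_v^{m+1}}\bigg(\frac{|z|_v}{\exp(\mathcal G_{F,v}(G(z))/e)}\bigg)^{n_v(m+1)}d\mu_v(z),$$ where the volumes are finite and the integrals and the infinite product converge. Moreover, for every place $v$ of $K$, $$\lim_{i\to\infty}c_{K,v}(f^i\circ g)=\begin{cases}\mu_v\{z\in K_v^{m+1}:\exp\mathcal G_{F,v}(G(z))\le|\hat F\circ G|_v\}& v\mid\infty\\[1ex]\displaystyle\int_{O_v^{m+1}}\bigg(\frac{|z|_v\,|\hat F\circ G|_v^{1/e}}{\exp(\mathcal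 G_{F,v}(G(z))/e)}\bigg)^{n_v(m+1)}d\mu_v(z)& v\nmid\infty,\end{cases}$$ where again the volume is finite and the integral converges. -/

import Mathlib

open Filter Topology MeasureTheory NumberField IsDedekindDomain

noncomputable section

namespace DynSchanuel

/-! ### Morphisms of projective spaces and their lifts -/

/-- A lift of a morphism `ℙ^m → ℙ^M` of degree `deg` defined over `K`: a tuple of `M + 1` forms of
degree `deg` in `m + 1` variables over `K`, without common zero over the algebraic closure (other
than the origin). -/
structure ProjLift (K : Type*) [Field K] (m M : ℕ) where
  /-- the common degree of the forms -/
  deg : ℕ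
  /-- the forms `F_0, …, F_M` -/
  form : Fin (M + 1) → MvPolynomial (Fin (m + 1)) K
  isHomogeneous : ∀ j, (form j).IsHomogeneous deg
  eq_zero_of_common_zero : ∀ x : Fin (m + 1) → AlgebraicClosure K,
    (∀ j, MvPolynomial.aeval x (form j) = 0) → x = 0

namespace ProjLift

variable {K : Type*} [Field K] {l m M : ℕ}

/-- Composition `F ∘ G` of lifts: substitution of forms into forms. -/
def comp (F : ProjLift K m M) (G : ProjLift K l m) : ProjLift K l M where
  deg := F.deg * G.deg
  form j := MvPolynomial.bind₁ G.form (F.form j)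
  isHomogeneous j := by
    rw [mul_comm]
    exact (F.isHomogeneous j).aeval G.form G.isHomogeneous
  eq_zero_of_common_zero x hx := by
    refine G.eq_zero_of_common_zero x fun j => ?_
    have h := F.eq_zero_of_common_zero (fun i => MvPolynomial.aeval x (G.form i)) fun k => by
      rw [← hx k, MvPolynomial.aeval_bind₁]
    exact congrFun h j

/-- Two lifts define the same morphism iff they differ by a nonzero scalar. -/
instance setoid (K : Type*) [Field K] (m M : ℕ) : Setoid (ProjLift K m M) where
  r F F' := F.deg = F'.deg ∧ ∃ c : K, c ≠ 0 ∧ ∀ j, F'.form j = MvPolynomial.C c * F.form j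
  iseqv :=
    { refl := fun F => ⟨rfl, 1, one_ne_zero, fun j => by simp⟩
      symm := by
        rintro F F' ⟨hd, c, hc, h⟩
        refine ⟨hd.symm, c⁻¹, inv_ne_zero hc, fun j => ?_⟩
        rw [h j, ← mul_assoc, ← map_mul, inv_mul_cancel₀ hc, map_one, one_mul]
      trans := by
        rintro F F' F'' ⟨hd, c, hc, h⟩ ⟨hd', c', hc', h'⟩
        refine ⟨hd.trans hd', c' * c, mul_ne_zero hc' hc, fun j => ?_⟩
        rw [h' j, h j, map_mul, mul_assoc] }

theorem equiv_def {F F' : ProjLift K m M} :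
    F ≈ F' ↔ F.deg = F'.deg ∧ ∃ c : K, c ≠ 0 ∧ ∀ j, F'.form j = MvPolynomial.C c * F.form j :=
  Iff.rfl

theorem comp_equiv_comp {F F' : ProjLift K m M} (hF : F ≈ F') {G G' : ProjLift K l m}
    (hG : G ≈ G') : F.comp G ≈ F'.comp G' := by
  obtain ⟨hd, c, hc, h⟩ := hF
  obtain ⟨he, b, hb, h'⟩ := hG
  refine ⟨by simp [comp, hd, he], c * b ^ F.deg, mul_ne_zero hc (pow_ne_zero _ hb), fun j => ?_⟩
  have hG' : G'.form = fun i => MvPolynomial.C b * G.form i := funext h'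
  have key : MvPolynomial.bind₁ (fun i => MvPolynomial.C b * G.form i) (F.form j)
      = MvPolynomial.C b ^ F.deg * MvPolynomial.bind₁ G.form (F.form j) := by
    have hh := F.isHomogeneous j
    rw [(F.form j).as_sum, map_sum, map_sum, Finset.mul_sum]
    refine Finset.sum_congr rfl fun α hα => ?_
    have hα' : ∑ i, α i = F.deg := by
      have := hh (MvPolynomial.mem_support_iff.mp hα)
      rw [Finsupp.weight_apply, Finsupp.sum_fintype _ _ (by simp)] at this
      simpa using this
    simp only [MvPolynomial.bind₁_monomial, mul_pow]
    rw [Finset.prod_mul_distrib, Finset.prod_pow_eq_pow_sum]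
    have : ∑ i ∈ α.support, α i = F.deg := by
      rw [← hα']
      exact Finset.sum_subset (Finset.subset_univ _) (by simp)
    rw [this]
    ring
  simp only [comp, h j, hG', map_mul, MvPolynomial.bind₁_C_right, key, map_pow, mul_assoc]

end ProjLift

/-- Morphisms `ℙ^m → ℙ^M` defined over `K`: lifts up to a nonzero scalar. -/
def ProjMorphism (K : Type*) [Field K] (m M : ℕ) : Type _ :=
  Quotient (ProjLift.setoid K m M)

namespace ProjMorphism

variable {K : Type*} [Field K] {l m M : ℕ}

/-- `F` is a lift of `f`. -/
def IsLift (f : ProjMorphism K m M) (F : ProjLift K m M) : Prop :=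
  Quotient.mk _ F = f

/-- The degree of a morphism. -/
def deg (f : ProjMorphism K m M) : ℕ :=
  Quotient.lift (fun F : ProjLift K m M => F.deg)
    (fun _ _ h => (ProjLift.equiv_def.mp h).1) f

/-- Composition `f ∘ g` of morphisms. The morphism `f^i ∘ g` is `f.comp^[i] g`. -/
def comp (f : ProjMorphism K m M) (g : ProjMorphism K l m) : ProjMorphism K l M :=
  Quotient.map₂ ProjLift.comp (fun _ _ hF _ _ hG => ProjLift.comp_equiv_comp hF hG) f g

end ProjMorphism

/-! ### Absolute values of points and of lifts

Here `L` is an extension field of `K` and `abv : L → ℝ` is an absolute value on `L`. -/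

section AbsoluteValues

variable {K : Type*} [Field K] {L : Type*} [Field L] [Algebra K L] {m M : ℕ}

/-- The value `F(x)` of a lift at a point with coordinates in `L`. -/
def ProjLift.eval (F : ProjLift K m M) (x : Fin (m + 1) → L) : Fin (M + 1) → L :=
  fun j => MvPolynomial.aeval x (F.form j)

/-- The absolute value of a tuple: the maximum of the absolute values of its entries. -/
def tupleAbs (abv : L → ℝ) (x : Fin (m + 1) → L) : ℝ :=
  ⨆ j, abv (x j)

/-- The family of all coefficients `F_{j,α}` of a lift, where `j = 0, …, M` and `α` runs through
the exponents of degree `deg F` in `m + 1` variables. -/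
def ProjLift.coeffs (F : ProjLift K m M) :
    Fin (M + 1) × (Finset.finsuppAntidiag (Finset.univ : Finset (Fin (m + 1))) F.deg) → K :=
  fun p => (F.form p.1).coeff p.2

/-- The absolute value `|F|` of a lift: the maximum of the absolute values of its coefficients. -/
def ProjLift.coeffAbs (abv : L → ℝ) (F : ProjLift K m M) : ℝ :=
  ⨆ p, abv (algebraMap K L (F.coeffs p))

/-- The Green's function `x ↦ lim_i log |F^i(x)| / d^i`, where `d = deg F`. It is of interest at
`x ≠ 0` only. -/
def green (abv : L → ℝ) (F : ProjLift K M M) (x : Fin (M + 1) → L) : ℝ :=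
  limUnder atTop fun i : ℕ => Real.log (tupleAbs abv (F.eval^[i] x)) / (F.deg : ℝ) ^ i

/-- The quantity `lim_i |F^i ∘ G|^(1/d^i)`, where `d = deg F`. -/
def hatAbs (abv : L → ℝ) (F : ProjLift K M M) (G : ProjLift K m M) : ℝ :=
  limUnder atTop fun i : ℕ => (F.comp^[i] G).coeffAbs abv ^ (1 / (F.deg : ℝ) ^ i)

theorem ProjLift.coeffAbs_of_equiv {abv : L → ℝ} (hmul : ∀ x y, abv (x * y) = abv x * abv y)
    (hnn : ∀ x, 0 ≤ abv x) {F F' : ProjLift K m M} (hd : F.deg = F'.deg) {c : K}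
    (h : ∀ j, F'.form j = MvPolynomial.C c * F.form j) :
    F'.coeffAbs abv = abv (algebraMap K L c) * F.coeffAbs abv := by
  obtain ⟨d, φ, _, _⟩ := F
  obtain ⟨d', φ', _, _⟩ := F'
  dsimp only at hd h
  subst hd
  simp only [ProjLift.coeffAbs, ProjLift.coeffs, h, MvPolynomial.coeff_C_mul, map_mul,
    hmul, Real.mul_iSup_of_nonneg (hnn _)]

theorem ProjLift.tupleAbs_eval_of_equiv {abv : L → ℝ}
    (hmul : ∀ x y, abv (x * y) = abv x * abv y)
    (hnn : ∀ x, 0 ≤ abv x) {F F' : ProjLift K m M} {c : K}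
    (h : ∀ j, F'.form j = MvPolynomial.C c * F.form j) (z : Fin (m + 1) → L) :
    tupleAbs abv (F'.eval z) = abv (algebraMap K L c) * tupleAbs abv (F.eval z) := by
  simp only [tupleAbs, ProjLift.eval, h, map_mul, MvPolynomial.aeval_C, hmul,
    Real.mul_iSup_of_nonneg (hnn _)]

end AbsoluteValues

/-! ### Archimedean places: absolute value, Lebesgue measure, local factor -/

section Archimedean

variable {K : Type*} [Field K] {m M : ℕ}

instance (v : InfinitePlace K) : MeasurableSpace v.Completion := borel _

instance (v : InfinitePlace K) : BorelSpace v.Completion := ⟨rfl⟩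

/-- The absolute value on the completion at an archimedean place; it extends `|σ(x)|`. -/
def absInf (v : InfinitePlace K) (x : v.Completion) : ℝ := ‖x‖

open Classical in
/-- Lebesgue measure on `K_v`, transported from `ℝ` or `ℂ`. -/
def lebesgueInf (v : InfinitePlace K) : Measure v.Completion :=
  if hv : v.IsReal then
    (volume : Measure ℝ).map (InfinitePlace.Completion.isometryEquivRealOfIsReal hv).symm
  else
    (volume : Measure ℂ).map (InfinitePlace.Completion.isometryEquivComplexOfIsComplex
      (InfinitePlace.not_isReal_iff_isComplex.mp hv)).symm

/-- Lebesgue measure on `K_v^{m+1}`. -/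
def muInf (v : InfinitePlace K) (m : ℕ) : Measure (Fin (m + 1) → v.Completion) :=
  Measure.pi fun _ => lebesgueInf v

/-- The local fundamental domain `{z : |F(z)|_v ≤ |F|_v}` at an archimedean place. -/
def domainInf (v : InfinitePlace K) (F : ProjLift K m M) : Set (Fin (m + 1) → v.Completion) :=
  {z | tupleAbs (absInf v) (F.eval z) ≤ F.coeffAbs (absInf v)}

theorem domainInf_congr (v : InfinitePlace K) {F F' : ProjLift K m M} (h : F ≈ F') :
    domainInf v F = domainInf v F' := by
  obtain ⟨hd, c, hc, h⟩ := ProjLift.equiv_def.mp h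
  have hpos : 0 < absInf v (algebraMap K v.Completion c) :=
    norm_pos_iff.mpr ((map_ne_zero _).mpr hc)
  ext z
  simp only [domainInf, Set.mem_ofPred_eq,
    ProjLift.tupleAbs_eval_of_equiv (abv := absInf v) norm_mul norm_nonneg h,
    ProjLift.coeffAbs_of_equiv (abv := absInf v) norm_mul norm_nonneg hd h,
    mul_le_mul_iff_right₀ hpos]

/-- The local factor `c_{K,v}(f)` at an archimedean place. -/
def localFactorInf (v : InfinitePlace K) (f : ProjMorphism K m M) : ℝ :=
  Quotient.lift (fun F : ProjLift K m M => (muInf v m).real (domainInf v F))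
    (fun _ _ h => by rw [domainInf_congr v h]) f

end Archimedean

/-! ### Nonarchimedean places: absolute value, Haar measure, local factor -/

section Nonarchimedean

variable (K : Type*) [Field K] [NumberField K] (v : HeightOneSpectrum (𝓞 K))

theorem exists_integer_sub_lt_one (y : v.adicCompletion K) (hy : Valued.v y ≤ 1) :
    ∃ a : 𝓞 K, Valued.v (y - ((algebraMap (𝓞 K) K a : K) : v.adicCompletion K)) < 1 := by
  have hopen : {z : v.adicCompletion K | Valued.v (y - z) < 1} ∈ 𝓝 y := by
    have h1 : Metric.ball y 1 ∈ 𝓝 y := Metric.ball_mem_nhds y one_pos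
    refine Filter.mem_of_superset h1 fun z hz => ?_
    rw [Metric.mem_ball, dist_comm, dist_eq_norm] at hz
    exact (Valued.toNormedField.norm_lt_one_iff).mp hz
  obtain ⟨k, hk⟩ := (v.denseRange_algebraMap K).mem_nhds hopen
  have hk' : Valued.v (y - (k : v.adicCompletion K)) < 1 := hk
  have hk1 : v.valuation K k ≤ 1 := by
    rw [← HeightOneSpectrum.valuedAdicCompletion_eq_valuation' v k]
    have : (k : v.adicCompletion K) = y - (y - k) := by ring
    rw [this]
    exact (Valuation.map_sub _ _ _).trans (max_le hy hk'.le)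
  obtain ⟨a, ha⟩ := v.exists_valuation_sub_lt_of_integer hk1 1
  refine ⟨a, ?_⟩
  have ha' : Valued.v (((algebraMap (𝓞 K) K a : K) : v.adicCompletion K) - k) < 1 := by
    have := HeightOneSpectrum.valuedAdicCompletion_eq_valuation' v (algebraMap (𝓞 K) K a - k)
    have h2 : ((algebraMap (𝓞 K) K a - k : K) : v.adicCompletion K)
        = ((algebraMap (𝓞 K) K a : K) : v.adicCompletion K) - k :=
      map_sub (algebraMap K (v.adicCompletion K)) _ _
    rw [← h2, this]
    simpa using ha
  have : y - ((algebraMap (𝓞 K) K a : K) : v.adicCompletion K)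
      = (y - k) - (((algebraMap (𝓞 K) K a : K) : v.adicCompletion K) - k) := by ring
  rw [this]
  exact (Valuation.map_sub _ _ _).trans_lt (max_lt hk' ha')

instance properSpace_adicCompletion : ProperSpace (v.adicCompletion K) := by
  rw [Valued.integer.properSpace_iff_completeSpace_and_isDiscreteValuationRing_integer_and_finite_residueField]
  refine ⟨inferInstance,
    inferInstanceAs (IsDiscreteValuationRing (v.adicCompletionIntegers K)), ?_⟩
  change Finite (IsLocalRing.ResidueField (v.adicCompletionIntegers K))
  let φ : 𝓞 K →+* IsLocalRing.ResidueField (v.adicCompletionIntegers K) :=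
    (IsLocalRing.residue _).comp (algebraMap (𝓞 K) (v.adicCompletionIntegers K))
  have hmem : ∀ z : v.adicCompletionIntegers K,
      IsLocalRing.residue _ z = 0 ↔ Valued.v (z : v.adicCompletion K) < 1 := fun z => by
    rw [IsLocalRing.residue_eq_zero_iff]
    exact Valuation.mem_maximalIdeal_iff
      (v := (Valued.v : Valuation (v.adicCompletion K) (WithZero (Multiplicative ℤ))))
  have hker : ∀ a ∈ v.asIdeal, φ a = 0 := fun a ha => by
    refine (hmem _).mpr ?_
    change Valued.v ((algebraMap (𝓞 K) K a : K) : v.adicCompletion K) < 1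
    rw [HeightOneSpectrum.valuedAdicCompletion_eq_valuation' v]
    exact (v.valuation_lt_one_iff_mem a).mpr ha
  have hfin : Finite (𝓞 K ⧸ v.asIdeal) := v.asIdeal.finiteQuotientOfFreeOfNeBot v.ne_bot
  refine Finite.of_surjective (Ideal.Quotient.lift v.asIdeal φ hker) fun r => ?_
  obtain ⟨y, rfl⟩ := IsLocalRing.residue_surjective r
  obtain ⟨a, ha⟩ := exists_integer_sub_lt_one K v y y.2
  refine ⟨Ideal.Quotient.mk _ a, ?_⟩
  rw [Ideal.Quotient.lift_mk, eq_comm, ← sub_eq_zero]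
  change IsLocalRing.residue _ y - IsLocalRing.residue _ _ = 0
  rw [← map_sub, hmem]
  exact ha

instance : MeasurableSpace (v.adicCompletion K) := borel _

instance : BorelSpace (v.adicCompletion K) := ⟨rfl⟩

variable {K} {m M : ℕ}

/-- The local degree `n_v = e_v f_v` of a prime ideal. -/
def localDegree (v : HeightOneSpectrum (𝓞 K)) : ℕ :=
  v.asIdeal.ramificationIdx ℤ * v.asIdeal.inertiaDeg ℤ

/-- The absolute value `N(v)^{-ord_v(x) / n_v}` on the completion at a prime ideal `v`; Mathlib's
norm is `‖x‖ = N(v)^{-ord_v(x)}`. -/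
def absFin (v : HeightOneSpectrum (𝓞 K)) (x : v.adicCompletion K) : ℝ :=
  ‖x‖ ^ (1 / (localDegree v : ℝ))

/-- The unit polydisc `O_v^{m+1}` in `K_v^{m+1}`, for the maximum norm. -/
def polydisc (v : HeightOneSpectrum (𝓞 K)) (m : ℕ) :
    TopologicalSpace.PositiveCompacts (Fin (m + 1) → v.adicCompletion K) where
  carrier := Metric.closedBall 0 1
  isCompact' := isCompact_closedBall 0 1
  interior_nonempty' :=
    ⟨0, Metric.ball_subset_interior_closedBall (Metric.mem_ball_self one_pos)⟩

/-- The Haar measure on `K_v^{m+1}` that gives the unit polydisc measure one. -/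
def muFin (v : HeightOneSpectrum (𝓞 K)) (m : ℕ) : Measure (Fin (m + 1) → v.adicCompletion K) :=
  Measure.addHaarMeasure (polydisc v m)

/-- The integral of `(|z| |F|^{1/d} / |F(z)|^{1/d})^{n_v (m+1)}` over the unit polydisc. -/
def integralFin (v : HeightOneSpectrum (𝓞 K)) (F : ProjLift K m M) : ℝ :=
  ∫ z in (polydisc v m : Set (Fin (m + 1) → v.adicCompletion K)),
    (tupleAbs (absFin v) z * F.coeffAbs (absFin v) ^ (1 / (F.deg : ℝ)) /
      tupleAbs (absFin v) (F.eval z) ^ (1 / (F.deg : ℝ))) ^ (localDegree v * (m + 1)) ∂(muFin v m)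

theorem absFin_mul (x y : v.adicCompletion K) : absFin v (x * y) = absFin v x * absFin v y := by
  rw [absFin, norm_mul, Real.mul_rpow (norm_nonneg _) (norm_nonneg _), absFin, absFin]

theorem absFin_nonneg (x : v.adicCompletion K) : 0 ≤ absFin v x :=
  Real.rpow_nonneg (norm_nonneg _) _

theorem integralFin_congr {F F' : ProjLift K m M} (h : F ≈ F') :
    integralFin v F = integralFin v F' := by
  obtain ⟨hd, c, hc, h⟩ := ProjLift.equiv_def.mp h
  have hpos : 0 < absFin v (algebraMap K (v.adicCompletion K) c) :=
    Real.rpow_pos_of_pos (norm_pos_iff.mpr ((map_ne_zero _).mpr hc)) _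
  have hne := (Real.rpow_pos_of_pos hpos (1 / (F.deg : ℝ))).ne'
  have hF : 0 ≤ F.coeffAbs (absFin v) := Real.iSup_nonneg fun _ => absFin_nonneg v _
  have hFz : ∀ z : Fin (m + 1) → v.adicCompletion K, 0 ≤ tupleAbs (absFin v) (F.eval z) :=
    fun z => Real.iSup_nonneg fun _ => absFin_nonneg v _
  simp only [integralFin, ← hd,
    ProjLift.tupleAbs_eval_of_equiv (absFin_mul v) (absFin_nonneg v) h,
    ProjLift.coeffAbs_of_equiv (absFin_mul v) (absFin_nonneg v) hd h,
    Real.mul_rpow hpos.le hF, Real.mul_rpow hpos.le (hFz _), mul_left_comm (tupleAbs _ _),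
    mul_div_mul_left _ _ hne]

/-- The local factor `c_{K,v}(f)` at a nonarchimedean place. -/
def localFactorFin (v : HeightOneSpectrum (𝓞 K)) (f : ProjMorphism K m M) : ℝ :=
  Quotient.lift (fun F : ProjLift K m M => integralFin v F)
    (fun _ _ h => integralFin_congr v h) f

end Nonarchimedean

/-! ### The global constants -/

section Global

variable (K : Type*) [Field K] [NumberField K]

/-- The constant `c_K(m) = h R (m+1)^r / (w ζ_K(m+1)) * (2^{r_2} / √|disc K|)^{m+1}`. -/
def fieldConstant (m : ℕ) : ℝ :=
  (classNumber K * Units.regulator K * (m + 1 : ℝ) ^ Units.rank K) /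
      (Units.torsionOrder K * (dedekindZeta K (m + 1 : ℂ)).re) *
    (2 ^ InfinitePlace.nrComplexPlaces K / Real.sqrt |(discr K : ℝ)|) ^ (m + 1)

variable {K} {m M : ℕ}

theorem mulHeight_coeffs_congr {F F' : ProjLift K m M} (hFF' : F ≈ F') :
    Height.mulHeight F.coeffs = Height.mulHeight F'.coeffs := by
  obtain ⟨hd, c, hc, h⟩ := ProjLift.equiv_def.mp hFF'
  clear hFF'
  obtain ⟨d, φ, hφ, hz⟩ := F
  obtain ⟨d', φ', hφ', hz'⟩ := F'
  dsimp only at hd h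
  subst hd
  have key : (ProjLift.mk d φ' hφ' hz').coeffs = c • (ProjLift.mk d φ hφ hz).coeffs := by
    funext p
    simp [ProjLift.coeffs, h, MvPolynomial.coeff_C_mul]
  rw [key]
  exact (Height.mulHeight_smul_eq_mulHeight _ hc).symm

/-- The (absolute, multiplicative) height `H(f)` of a morphism: the height of the tuple of
coefficients of a lift. Mathlib's `Height.mulHeight` is relative to `K`, whence the `n`-th root. -/
def height (f : ProjMorphism K m M) : ℝ :=
  Quotient.lift
    (fun F : ProjLift K m M => Height.mulHeight F.coeffs ^ (1 / (Module.finrank ℚ K : ℝ)))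
    (fun F F' h => by simp only [mulHeight_coeffs_congr h]) f

/-- The constant
`c_K(f) = c_K(m) * ∏_{v ∣ ∞} c_{K,v}(f) * ∏_{v ∤ ∞} c_{K,v}(f) / H(f)^{n (m+1) / deg f}`. -/
def globalConstant (f : ProjMorphism K m M) : ℝ :=
  fieldConstant K m *
    (((∏ v : InfinitePlace K, localFactorInf v f) *
        ∏' v : HeightOneSpectrum (𝓞 K), localFactorFin v f) /
      height f ^ ((Module.finrank ℚ K * (m + 1) : ℝ) / f.deg))

/-- The constant `lim_i c_K(f^i ∘ g)`. -/
def hatConstant (f : ProjMorphism K M M) (g : ProjMorphism K m M) : ℝ :=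
  limUnder atTop fun i : ℕ => globalConstant (f.comp^[i] g)

end Global

/-! ### The Green's function expressions -/

section Expressions

variable {K : Type*} [Field K] {m M : ℕ}

/-- The set `{z ∈ K_v^{m+1} : 𝓖_{F,v}(G(z)) ≤ 0}`. -/
def greenDomain (v : InfinitePlace K) (F : ProjLift K M M) (G : ProjLift K m M) :
    Set (Fin (m + 1) → v.Completion) :=
  {z | green (absInf v) F (G.eval z) ≤ 0}

/-- The set `{z ∈ K_v^{m+1} : exp 𝓖_{F,v}(G(z)) ≤ lim_i |F^i ∘ G|_v^(1/d^i)}`. -/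
def hatDomain (v : InfinitePlace K) (F : ProjLift K M M) (G : ProjLift K m M) :
    Set (Fin (m + 1) → v.Completion) :=
  {z | Real.exp (green (absInf v) F (G.eval z)) ≤ hatAbs (absInf v) F G}

variable [NumberField K]

/-- The function `(|z|_v / exp (𝓖_{F,v}(G(z)) / e))^{n_v (m+1)}` on `K_v^{m+1}`, where
`e = deg G`. -/
def greenIntegrand (v : HeightOneSpectrum (𝓞 K)) (F : ProjLift K M M) (G : ProjLift K m M)
    (z : Fin (m + 1) → v.adicCompletion K) : ℝ :=
  (tupleAbs (absFin v) z / Real.exp (green (absFin v) F (G.eval z) / G.deg)) ^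
    (localDegree v * (m + 1))

/-- The function `(|z|_v A^{1/e} / exp (𝓖_{F,v}(G(z)) / e))^{n_v (m+1)}` on `K_v^{m+1}`, where
`e = deg G` and `A = lim_i |F^i ∘ G|_v^(1/d^i)`. -/
def hatIntegrand (v : HeightOneSpectrum (𝓞 K)) (F : ProjLift K M M) (G : ProjLift K m M)
    (z : Fin (m + 1) → v.adicCompletion K) : ℝ :=
  (tupleAbs (absFin v) z * hatAbs (absFin v) F G ^ (1 / (G.deg : ℝ)) /
      Real.exp (green (absFin v) F (G.eval z) / G.deg)) ^ (localDegree v * (m + 1))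

end Expressions

end DynSchanuel

end

open DynSchanuel

open Filter Topology MeasureTheory NumberField IsDedekindDomain

namespace DynSchanuel

/-! Everything rests on one estimate: if `F` is a lift of degree `d ≥ 1`, then `|F(x)|` lies between
`C⁻¹ |x|^d` and `C |x|^d`. The upper bound is the triangle inequality; the lower one follows from
the homogeneous Nullstellensatz, which writes a power of each variable as a combination of the forms
of `F`. The argument uses so little of the norm that it holds in any commutative `K`-algebra with a
norm satisfying `ν (a ^ n) = ν a ^ n` (`IsPowNorm.exists_eval_bounds`). Together with Tate's
telescoping (`exists_tendsto_log_div_pow`) it is applied in two rings.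

In the completion `K_v` it yields the Green's function with an error `B d^{-i}` uniform in the
point, and shows that `𝓖 ∘ G - e log |z|` is bounded. In the polynomial ring it yields the limit of
`|F^i ∘ G|^(1/d^i)`, because the forms of `F^(i+1) ∘ G` are `F` evaluated at the forms of `F^i ∘ G`
(`tendsto_hatAbs`). There the norm is the Gauss norm at a prime, power-multiplicative by Gauss's
lemma, and the supremum over the unit torus at an archimedean place. The latter differs from the
largest coefficient by a factor polynomial in the degree, which the `d^i`-th root kills.

The local factors then converge: at a prime by dominated convergence (`tendsto_integralFin`), at an
archimedean place because the domains are squeezed between sublevel sets of `𝓖 ∘ G` whose volume is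
a continuous function of the level (`tendsto_muInf_domainInf`).

For the global limit, outside one finite set of primes, independent of `i`, both lifts have good
reduction; all local factors and coefficient norms there equal one, so every product is finite. The
power of the height in `globalConstant` is a product of powers of `|F^i ∘ G|_v^(1/d^i)`, and its
limit is exactly the factor by which the local limits differ from the expressions with `𝓖 ∘ G` alone
(`tendsto_globalConstant`). -/

/-! ### Power-multiplicative norms -/

/-- A power-multiplicative seminorm `ν` on a `K`-algebra that restricts to `w` on scalars. -/
structure IsPowNorm {K R : Type*} [Field K] [CommRing R] [Algebra K R] (w : K → ℝ) (ν : R → ℝ) :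
    Prop where
  nonneg : ∀ a, 0 ≤ ν a
  map_zero : ν 0 = 0
  add_le : ∀ a b, ν (a + b) ≤ ν a + ν b
  mul_le : ∀ a b, ν (a * b) ≤ ν a * ν b
  map_pow : ∀ a n, ν (a ^ n) = ν a ^ n
  map_algebraMap : ∀ c, ν (algebraMap K R c) = w c

/-! ### Homogeneous Nullstellensatz -/

theorem homogeneousComponent_mul_of_isHomogeneous {σ R : Type*} [CommSemiring R]
    (p : MvPolynomial σ R) {q : MvPolynomial σ R} {d : ℕ} (hq : q.IsHomogeneous d) (n : ℕ) :
    MvPolynomial.homogeneousComponent (n + d) (p * q) =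
      MvPolynomial.homogeneousComponent n p * q := by
  have hp : p * q = ∑ i ∈ Finset.range (p.totalDegree + n + 1),
      MvPolynomial.homogeneousComponent i p * q := by
    rw [← Finset.sum_mul]
    congr 1
    conv_lhs => rw [← MvPolynomial.sum_homogeneousComponent p]
    -- The range is longer than the total degree requires, so that it surely contains `n`; the extra
    -- components vanish.
    refine Finset.sum_subset (Finset.range_mono (by omega)) fun i _ hi => ?_
    exact MvPolynomial.homogeneousComponent_eq_zero _ _ (by simpa using hi)
  rw [hp, map_sum, Finset.sum_eq_single n]
  · rw [MvPolynomial.homogeneousComponent_of_mem (m := n + d)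
      ((MvPolynomial.homogeneousComponent_isHomogeneous n p).mul hq), if_pos rfl]
  · intro i _ hi
    rw [MvPolynomial.homogeneousComponent_of_mem (n := i + d)
      ((MvPolynomial.homogeneousComponent_isHomogeneous i p).mul hq), if_neg (by omega)]
  · intro h
    simp at h

/-- Homogeneous form of the Nullstellensatz for a lift of a morphism of projective spaces. -/
theorem ProjLift.exists_X_pow_eq_sum {K : Type*} [Field K] {m M : ℕ} (F : ProjLift K m M) :
    ∃ (N : ℕ) (h : Fin (m + 1) → Fin (M + 1) → MvPolynomial (Fin (m + 1)) K),
      (∀ j k, (h j k).IsHomogeneous N) ∧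
      ∀ j, MvPolynomial.X j ^ (N + F.deg) = ∑ k, h j k * F.form k := by
  set I : Ideal (MvPolynomial (Fin (m + 1)) K) := Ideal.span (Set.range F.form) with hI
  have hrad : ∀ j, MvPolynomial.X j ∈ I.radical := fun j => by
    rw [← MvPolynomial.vanishingIdeal_zeroLocus_eq_radical (K := AlgebraicClosure K)]
    rw [MvPolynomial.mem_vanishingIdeal_iff]
    intro x hx
    have hx0 : x = 0 := by
      refine F.eq_zero_of_common_zero x fun k => ?_
      exact (MvPolynomial.mem_zeroLocus_iff.mp hx) _ (Ideal.subset_span ⟨k, rfl⟩)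
    simp [hx0]
  choose n hn using hrad
  -- One exponent for all variables. Adding `F.deg` lets the component of this degree be taken on
  -- both sides, leaving cofactors of degree `∑ i, n i`.
  have hpow : ∀ j, MvPolynomial.X j ^ (∑ i, n i + F.deg) ∈ I := fun j =>
    I.pow_mem_of_pow_mem (hn j)
      ((Finset.single_le_sum (fun _ _ => Nat.zero_le _) (Finset.mem_univ j)).trans
        (Nat.le_add_right _ _))
  simp only [hI, Ideal.mem_span_range_iff_exists_fun] at hpow
  choose c hc using hpow
  refine ⟨∑ i, n i, fun j k => MvPolynomial.homogeneousComponent (∑ i, n i) (c j k),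
    fun j k => MvPolynomial.homogeneousComponent_isHomogeneous _ _, fun j => ?_⟩
  have h1 := congrArg (MvPolynomial.homogeneousComponent (∑ i, n i + F.deg)) (hc j)
  rw [map_sum, MvPolynomial.homogeneousComponent_of_mem (m := ∑ i, n i + F.deg)
    (MvPolynomial.isHomogeneous_X_pow j _), if_pos rfl] at h1
  rw [← h1]
  exact Finset.sum_congr rfl fun k _ =>
    homogeneousComponent_mul_of_isHomogeneous _ (F.isHomogeneous k) _

/-! ### Two-sided bounds for the values of a lift -/

section Bounds

variable {K R : Type*} [Field K] [CommRing R] [Algebra K R] {w : K → ℝ} {ν : R → ℝ}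

theorem IsPowNorm.le_iSup {R : Type*} {ν : R → ℝ} {m : ℕ} (x : Fin (m + 1) → R) (i : Fin (m + 1)) :
    ν (x i) ≤ ⨆ j, ν (x j) :=
  le_ciSup (f := fun j => ν (x j)) (Set.finite_range _).bddAbove i

theorem IsPowNorm.map_one (hν : IsPowNorm w ν) : ν 1 = 1 := by
  -- `0 ^ 0 = 1` in the ring and in the real numbers.
  simpa using hν.map_pow 0 0

theorem IsPowNorm.iSup_nonneg (hν : IsPowNorm w ν) {m : ℕ} (x : Fin (m + 1) → R) :
    0 ≤ ⨆ j, ν (x j) :=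
  Real.iSup_nonneg fun _ => hν.nonneg _

theorem IsPowNorm.monomial_le (hν : IsPowNorm w ν) {m : ℕ} (x : Fin (m + 1) → R)
    (s : Fin (m + 1) →₀ ℕ) (c : K) :
    ν (algebraMap K R c * ∏ i, x i ^ s i) ≤ w c * (⨆ j, ν (x j)) ^ (∑ i, s i) := by
  have hprod : ∀ t : Finset (Fin (m + 1)),
      ν (∏ i ∈ t, x i ^ s i) ≤ (⨆ j, ν (x j)) ^ (∑ i ∈ t, s i) := fun t => by
    induction t using Finset.cons_induction with
    | empty => simp [hν.map_one]
    | cons a t ha ih =>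
      rw [Finset.prod_cons, Finset.sum_cons, pow_add]
      refine (hν.mul_le _ _).trans (mul_le_mul ?_ ih (hν.nonneg _)
        (pow_nonneg (hν.iSup_nonneg x) _))
      rw [hν.map_pow]
      exact pow_le_pow_left₀ (hν.nonneg _) (IsPowNorm.le_iSup x a) _
  refine (hν.mul_le _ _).trans ?_
  rw [hν.map_algebraMap]
  exact mul_le_mul_of_nonneg_left (hprod _) (hν.map_algebraMap c ▸ hν.nonneg _)

theorem aeval_eq_sum_of_fintype {σ : Type*} [Fintype σ] (P : MvPolynomial σ K) (x : σ → R) :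
    MvPolynomial.aeval x P = ∑ s ∈ P.support, algebraMap K R (P.coeff s) * ∏ i, x i ^ s i := by
  rw [MvPolynomial.aeval_def, MvPolynomial.eval₂_eq']

theorem sum_eq_of_mem_support {m D : ℕ} {P : MvPolynomial (Fin (m + 1)) K}
    (hP : P.IsHomogeneous D) {s : Fin (m + 1) →₀ ℕ} (hs : s ∈ P.support) : ∑ i, s i = D := by
  rw [hP.degree_eq_sum_deg_support hs]
  exact (Finset.sum_subset (Finset.subset_univ _) (by simp)).symm

theorem IsPowNorm.sum_le (hν : IsPowNorm w ν) {ι : Type*} (t : Finset ι) (f : ι → R) :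
    ν (∑ i ∈ t, f i) ≤ ∑ i ∈ t, ν (f i) := by
  induction t using Finset.cons_induction with
  | empty => simp [hν.map_zero]
  | cons a t ha ih =>
    rw [Finset.sum_cons, Finset.sum_cons]
    exact (hν.add_le _ _).trans (by gcongr)

theorem IsPowNorm.aeval_le (hν : IsPowNorm w ν) {m D : ℕ} {P : MvPolynomial (Fin (m + 1)) K}
    (hP : P.IsHomogeneous D) (x : Fin (m + 1) → R) :
    ν (MvPolynomial.aeval x P) ≤ (∑ s ∈ P.support, w (P.coeff s)) * (⨆ j, ν (x j)) ^ D := by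
  rw [aeval_eq_sum_of_fintype, Finset.sum_mul]
  refine (hν.sum_le _ _).trans (Finset.sum_le_sum fun s hs => ?_)
  have := hν.monomial_le x s (P.coeff s)
  rwa [sum_eq_of_mem_support hP hs] at this

theorem nonarch_sum_le (h0 : ν 0 = 0) (hna : IsNonarchimedean ν) {ι : Type*} (t : Finset ι)
    (f : ι → R) {B : ℝ} (hB : 0 ≤ B) (hf : ∀ i ∈ t, ν (f i) ≤ B) : ν (∑ i ∈ t, f i) ≤ B := by
  induction t using Finset.cons_induction with
  | empty => simpa [h0] using hB
  | cons a t ha ih =>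
    rw [Finset.sum_cons]
    exact (hna _ _).trans (max_le (hf _ (by simp)) (ih fun i hi => hf i (by simp [hi])))

theorem IsPowNorm.aeval_le_of_nonarch (hν : IsPowNorm w ν) (hna : IsNonarchimedean ν) {m D : ℕ}
    {P : MvPolynomial (Fin (m + 1)) K} (hP : P.IsHomogeneous D) (hw : ∀ s, w (P.coeff s) ≤ 1)
    (x : Fin (m + 1) → R) :
    ν (MvPolynomial.aeval x P) ≤ (⨆ j, ν (x j)) ^ D := by
  rw [aeval_eq_sum_of_fintype]
  refine nonarch_sum_le hν.map_zero hna _ _ (pow_nonneg (hν.iSup_nonneg x) _) fun s hs => ?_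
  have := hν.monomial_le x s (P.coeff s)
  rw [sum_eq_of_mem_support hP hs] at this
  exact this.trans (mul_le_of_le_one_left (pow_nonneg (hν.iSup_nonneg x) _) (hw s))

/-- If `a j ^ (N + d) ≤ A * a ^ N * b` for every `j`, then `a ^ d ≤ A * b`, where `a = max a j`. -/
theorem iSup_pow_le_of_pow_add_le {m N d : ℕ} {a : Fin (m + 1) → ℝ} {A b : ℝ}
    (ha : ∀ j, 0 ≤ a j) (hb : 0 ≤ b) (hA : 1 ≤ A) (hzero : (⨆ j, a j) = 0 → d = 0 → 1 ≤ b)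
    (h : ∀ j, a j ^ (N + d) ≤ A * (⨆ j, a j) ^ N * b) : (⨆ j, a j) ^ d ≤ A * b := by
  obtain ⟨j, hj⟩ := exists_eq_ciSup_of_finite (f := a)
  rcases (Real.iSup_nonneg ha).eq_or_lt with h0 | hpos
  · rw [← h0]
    rcases Nat.eq_zero_or_pos d with rfl | hd
    · have := hzero h0.symm rfl
      rw [pow_zero]
      nlinarith
    · rw [zero_pow hd.ne']
      positivity
  · have := h j
    rw [hj, pow_add, mul_comm A, mul_assoc] at this
    exact le_of_mul_le_mul_left this (pow_pos hpos _)

/-- For the lower bound, evaluate `X_j^(N+d) = ∑ h_jk F_k` at `x` and apply `ν`.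
Power-multiplicativity turns the left side into `ν (x_j)^(N+d)`, the homogeneous cofactors
contribute at most a constant times `|x|^N`, and `|x|^N` cancels for the largest coordinate. Full
multiplicativity is never needed, so a polynomial ring may take the place of a field. -/
theorem IsPowNorm.exists_eval_bounds (hν : IsPowNorm w ν) {m M : ℕ} (F : ProjLift K m M)
    (hd : 1 ≤ F.deg) :
    ∃ C : ℝ, 1 ≤ C ∧ ∀ x : Fin (m + 1) → R,
      (⨆ k, ν (MvPolynomial.aeval x (F.form k))) ≤ C * (⨆ j, ν (x j)) ^ F.deg ∧
      (⨆ j, ν (x j)) ^ F.deg ≤ C * ⨆ k, ν (MvPolynomial.aeval x (F.form k)) := by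
  have hw : ∀ c, 0 ≤ w c := fun c => hν.map_algebraMap c ▸ hν.nonneg _
  obtain ⟨N, h, hh, hX⟩ := F.exists_X_pow_eq_sum
  set A : ℝ := ∑ k, ∑ s ∈ (F.form k).support, w ((F.form k).coeff s) with hAdef
  set B : ℝ := ∑ j, ∑ k, ∑ s ∈ (h j k).support, w ((h j k).coeff s) with hBdef
  have hA0 : 0 ≤ A := Finset.sum_nonneg fun _ _ => Finset.sum_nonneg fun _ _ => hw _
  have hB0 : 0 ≤ B := Finset.sum_nonneg fun _ _ => Finset.sum_nonneg fun _ _ =>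
    Finset.sum_nonneg fun _ _ => hw _
  refine ⟨1 + A + B, by linarith, fun x => ⟨?_, ?_⟩⟩
  · refine ciSup_le fun k => (hν.aeval_le (F.isHomogeneous k) x).trans ?_
    refine mul_le_mul_of_nonneg_right ?_ (pow_nonneg (hν.iSup_nonneg x) _)
    have : ∑ s ∈ (F.form k).support, w ((F.form k).coeff s) ≤ A :=
      Finset.single_le_sum (f := fun k => ∑ s ∈ (F.form k).support, w ((F.form k).coeff s))
        (fun _ _ => Finset.sum_nonneg fun _ _ => hw _) (Finset.mem_univ k)
    linarith
  · refine iSup_pow_le_of_pow_add_le (N := N) (fun j => hν.nonneg _) (hν.iSup_nonneg _)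
      (by linarith) (fun _ h0 => by omega) fun j => ?_
    have hXj := congrArg (MvPolynomial.aeval x) (hX j)
    rw [_root_.map_pow, MvPolynomial.aeval_X, map_sum] at hXj
    rw [← hν.map_pow, hXj]
    have hBj : ∑ k, ∑ s ∈ (h j k).support, w ((h j k).coeff s) ≤ B :=
      Finset.single_le_sum (f := fun j => ∑ k, ∑ s ∈ (h j k).support, w ((h j k).coeff s))
        (fun _ _ => Finset.sum_nonneg fun _ _ => Finset.sum_nonneg fun _ _ => hw _)
        (Finset.mem_univ j)
    calc ν (∑ k, MvPolynomial.aeval x (h j k * F.form k))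
        ≤ ∑ k, ν (MvPolynomial.aeval x (h j k * F.form k)) := hν.sum_le _ _
      _ ≤ ∑ k, (∑ s ∈ (h j k).support, w ((h j k).coeff s)) * ((⨆ j, ν (x j)) ^ N *
            ⨆ k, ν (MvPolynomial.aeval x (F.form k))) := by
          refine Finset.sum_le_sum fun k _ => ?_
          rw [map_mul, ← mul_assoc]
          refine (hν.mul_le _ _).trans (mul_le_mul (hν.aeval_le (hh j k) x)
            (IsPowNorm.le_iSup (fun k => MvPolynomial.aeval x (F.form k)) k) (hν.nonneg _)
            (mul_nonneg (Finset.sum_nonneg fun _ _ => hw _) (pow_nonneg (hν.iSup_nonneg x) _)))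
      _ ≤ (1 + A + B) * (⨆ j, ν (x j)) ^ N * ⨆ k, ν (MvPolynomial.aeval x (F.form k)) := by
          rw [← Finset.sum_mul, mul_assoc]
          refine mul_le_mul_of_nonneg_right (by linarith)
            (mul_nonneg (pow_nonneg (hν.iSup_nonneg x) _) (hν.iSup_nonneg _))

/-- Integrality of a lift and of a Nullstellensatz certificate, with respect to `w`. -/
def ProjLift.HasGoodReduction {m M : ℕ} (F : ProjLift K m M) (w : K → ℝ) : Prop :=
  ∃ (N : ℕ) (h : Fin (m + 1) → Fin (M + 1) → MvPolynomial (Fin (m + 1)) K),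
    (∀ j k, (h j k).IsHomogeneous N) ∧
    (∀ j, MvPolynomial.X j ^ (N + F.deg) = ∑ k, h j k * F.form k) ∧
    (∀ j k s, w ((h j k).coeff s) ≤ 1) ∧ ∀ k s, w ((F.form k).coeff s) ≤ 1

/-- The estimates of `IsPowNorm.exists_eval_bounds`, with the ultrametric inequality in place of the
triangle inequality: integral coefficients of the lift and of the certificate bring both constants
down to one. -/
theorem IsPowNorm.iSup_eval_eq (hν : IsPowNorm w ν) (hna : IsNonarchimedean ν) {m M : ℕ}
    {F : ProjLift K m M} (hd : 1 ≤ F.deg) (hF : F.HasGoodReduction w) (x : Fin (m + 1) → R) :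
    (⨆ k, ν (MvPolynomial.aeval x (F.form k))) = (⨆ j, ν (x j)) ^ F.deg := by
  obtain ⟨N, h, hh, hX, hw, hw'⟩ := hF
  refine le_antisymm (ciSup_le fun k => hν.aeval_le_of_nonarch hna (F.isHomogeneous k) (hw' k) x) ?_
  rw [← one_mul (⨆ k, ν (MvPolynomial.aeval x (F.form k)))]
  refine iSup_pow_le_of_pow_add_le (N := N) (fun j => hν.nonneg _) (hν.iSup_nonneg _)
      le_rfl (fun _ h0 => by omega) fun j => ?_
  have hXj := congrArg (MvPolynomial.aeval x) (hX j)
  rw [_root_.map_pow, MvPolynomial.aeval_X, map_sum] at hXj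
  rw [← hν.map_pow, hXj, one_mul]
  refine nonarch_sum_le hν.map_zero hna _ _
    (mul_nonneg (pow_nonneg (hν.iSup_nonneg x) _) (hν.iSup_nonneg _)) fun k _ => ?_
  rw [map_mul]
  exact (hν.mul_le _ _).trans (mul_le_mul (hν.aeval_le_of_nonarch hna (hh j k) (hw j k) x)
    (IsPowNorm.le_iSup (fun k => MvPolynomial.aeval x (F.form k)) k) (hν.nonneg _)
    (pow_nonneg (hν.iSup_nonneg x) _))

end Bounds

/-! ### The Gauss norm and Gauss's lemma -/

section GaussNorm

variable {K : Type*} [Field K] {σ : Type*} (w : AbsoluteValue K ℝ)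

/-- The maximum of the absolute values of the coefficients of a polynomial. -/
noncomputable def gaussNorm (P : MvPolynomial σ K) : ℝ :=
  ⨆ s, w (P.coeff s)

theorem finite_range_abv_coeff (P : MvPolynomial σ K) :
    (Set.range fun s => w (P.coeff s)).Finite := by
  refine ((P.support.image fun s => w (P.coeff s)).finite_toSet.union
    (Set.finite_singleton 0)).subset ?_
  rintro _ ⟨s, rfl⟩
  by_cases hs : P.coeff s = 0
  · right; simp [hs]
  · left; exact Finset.mem_coe.mpr (Finset.mem_image.mpr ⟨s, by simpa using hs, rfl⟩)

theorem abv_coeff_le_gaussNorm (P : MvPolynomial σ K) (s : σ →₀ ℕ) :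
    w (P.coeff s) ≤ gaussNorm w P :=
  le_ciSup (f := fun s => w (P.coeff s)) (finite_range_abv_coeff w P).bddAbove s

theorem gaussNorm_le {P : MvPolynomial σ K} {B : ℝ} (h : ∀ s, w (P.coeff s) ≤ B) :
    gaussNorm w P ≤ B :=
  ciSup_le h

theorem gaussNorm_nonneg (P : MvPolynomial σ K) : 0 ≤ gaussNorm w P :=
  Real.iSup_nonneg fun _ => w.nonneg _

theorem gaussNorm_zero : gaussNorm w (0 : MvPolynomial σ K) = 0 := by
  simp [gaussNorm]

theorem exists_abv_coeff_eq_gaussNorm (P : MvPolynomial σ K) :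
    ∃ s, w (P.coeff s) = gaussNorm w P := by
  have := (Set.range_nonempty fun s => w (P.coeff s)).csSup_mem (finite_range_abv_coeff w P)
  exact this

theorem gaussNorm_pos {P : MvPolynomial σ K} (hP : P ≠ 0) : 0 < gaussNorm w P := by
  obtain ⟨s, hs⟩ := MvPolynomial.ne_zero_iff.mp hP
  exact (w.pos hs).trans_le (abv_coeff_le_gaussNorm w P s)

theorem gaussNorm_C (c : K) : gaussNorm w (MvPolynomial.C c : MvPolynomial σ K) = w c := by
  classical
  refine le_antisymm (gaussNorm_le w fun s => ?_) ?_
  · rw [MvPolynomial.coeff_C]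
    split_ifs <;> simp
  · simpa using abv_coeff_le_gaussNorm w (MvPolynomial.C c : MvPolynomial σ K) 0

theorem isNonarchimedean_gaussNorm (hw : IsNonarchimedean w) :
    IsNonarchimedean (gaussNorm w : MvPolynomial σ K → ℝ) := fun P Q =>
  gaussNorm_le w fun s => by
    rw [MvPolynomial.coeff_add]
    exact (hw _ _).trans (max_le_max (abv_coeff_le_gaussNorm w P s) (abv_coeff_le_gaussNorm w Q s))

/-- The lexicographically largest among the finitely many exponents that attain the Gauss norm; it
singles out a dominant term in a product. -/
theorem exists_max_index [LinearOrder σ] {P : MvPolynomial σ K} (hP : P ≠ 0) :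
    ∃ s, w (P.coeff s) = gaussNorm w P ∧
      ∀ t, toLex s < toLex t → w (P.coeff t) < gaussNorm w P := by
  obtain ⟨s₀, hs₀⟩ := exists_abv_coeff_eq_gaussNorm w P
  have hpos := gaussNorm_pos w hP
  have hmem : ∀ t, w (P.coeff t) = gaussNorm w P → t ∈ P.support := fun t ht => by
    rw [MvPolynomial.mem_support_iff]
    rintro h
    rw [h, w.map_zero] at ht
    exact hpos.ne ht
  obtain ⟨s, hs, hmax⟩ := (P.support.filter fun t => w (P.coeff t) = gaussNorm w P).exists_max_image
    toLex ⟨s₀, Finset.mem_filter.mpr ⟨hmem _ hs₀, hs₀⟩⟩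
  rw [Finset.mem_filter] at hs
  refine ⟨s, hs.2, fun t ht => (abv_coeff_le_gaussNorm w P t).lt_of_ne fun h => ?_⟩
  exact absurd (hmax t (Finset.mem_filter.mpr ⟨hmem _ h, h⟩)) (not_le.mpr ht)

/-- Gauss's lemma. Let `i`, `j` be the last exponents of `P` and `Q` attaining the norm. A pair `(a,
b) ≠ (i, j)` with `a + b = i + j` has `a > i` or `b > j`, so its product is strictly smaller, and
the ultrametric sum giving the coefficient of index `i + j` has the size of its dominant term. -/
theorem gaussNorm_mul [LinearOrder σ] (hw : IsNonarchimedean w) (P Q : MvPolynomial σ K) :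
    gaussNorm w (P * Q) = gaussNorm w P * gaussNorm w Q := by
  classical
  by_cases hP : P = 0
  · simp [hP, gaussNorm_zero]
  by_cases hQ : Q = 0
  · simp [hQ, gaussNorm_zero]
  refine le_antisymm (gaussNorm_le w fun s => ?_) ?_
  · rw [MvPolynomial.coeff_mul]
    refine nonarch_sum_le w.map_zero hw _ _
      (mul_nonneg (gaussNorm_nonneg w P) (gaussNorm_nonneg w Q)) fun p _ => ?_
    rw [w.map_mul]
    exact mul_le_mul (abv_coeff_le_gaussNorm w P _) (abv_coeff_le_gaussNorm w Q _) (w.nonneg _)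
      (gaussNorm_nonneg w P)
  · obtain ⟨i, hi, hi'⟩ := exists_max_index w hP
    obtain ⟨j, hj, hj'⟩ := exists_max_index w hQ
    have hpP := gaussNorm_pos w hP
    have hpQ := gaussNorm_pos w hQ
    have key : w ((P * Q).coeff (i + j)) = w (P.coeff i * Q.coeff j) := by
      rw [MvPolynomial.coeff_mul]
      refine hw.apply_sum_eq_of_lt (k := (i, j)) (fun a => (w.map_neg a).symm) (by simp) ?_
      rintro ⟨a, b⟩ hab hne
      rw [Finset.HasAntidiagonal.mem_antidiagonal] at hab
      rw [w.map_mul, w.map_mul, hi, hj]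
      rcases lt_trichotomy (toLex i) (toLex a) with h | h | h
      · exact mul_lt_mul_of_lt_of_le_of_nonneg_of_pos (hi' a h) (abv_coeff_le_gaussNorm w Q b)
          (w.nonneg _) hpQ
      · have : i = a := toLex.injective h
        subst this
        exact absurd (congrArg (Prod.mk i) (add_left_cancel hab)) hne
      · have hb : toLex j < toLex b := by
          by_contra hb
          have h1 : toLex a + toLex b < toLex i + toLex j := add_lt_add_of_lt_of_le h (not_lt.mp hb)
          exact h1.ne hab
        exact mul_lt_mul_of_le_of_lt_of_nonneg_of_pos (abv_coeff_le_gaussNorm w P a) (hj' b hb)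
          (w.nonneg _) hpP
    rw [← hi, ← hj, ← w.map_mul, ← key]
    exact abv_coeff_le_gaussNorm w _ _

theorem isPowNorm_gaussNorm [LinearOrder σ] (hw : IsNonarchimedean w) :
    IsPowNorm (R := MvPolynomial σ K) w (gaussNorm w) where
  nonneg := gaussNorm_nonneg w
  map_zero := gaussNorm_zero w
  add_le P Q := (isNonarchimedean_gaussNorm w hw P Q).trans
    (max_le_add_of_nonneg (gaussNorm_nonneg w P) (gaussNorm_nonneg w Q))
  mul_le P Q := (gaussNorm_mul w hw P Q).le
  map_pow P n := by
    induction n with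
    | zero =>
      rw [pow_zero, pow_zero, ← MvPolynomial.C_1, gaussNorm_C, w.map_one]
    | succ n ih => rw [pow_succ, pow_succ, gaussNorm_mul w hw, ih]
  map_algebraMap c := gaussNorm_C w c

end GaussNorm

/-! ### The supremum norm on the unit torus and Cauchy's estimate -/

section TorusNorm

variable {K : Type*} [Field K] {σ : Type*} (τ : K →+* ℂ)

/-- The maximum of the absolute value of a polynomial on the unit torus. -/
noncomputable def torusNorm (P : MvPolynomial σ K) : ℝ :=
  ⨆ z : σ → Circle, ‖MvPolynomial.eval₂ τ (fun i => (z i : ℂ)) P‖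

theorem torusNorm_nonneg (P : MvPolynomial σ K) : 0 ≤ torusNorm τ P :=
  Real.iSup_nonneg fun _ => norm_nonneg _

variable [Fintype σ]

theorem norm_eval₂_circle_le (P : MvPolynomial σ K) (z : σ → Circle) :
    ‖MvPolynomial.eval₂ τ (fun i => (z i : ℂ)) P‖ ≤ ∑ s ∈ P.support, ‖τ (P.coeff s)‖ := by
  rw [MvPolynomial.eval₂_eq']
  refine (norm_sum_le _ _).trans (Finset.sum_le_sum fun s _ => ?_)
  simp [norm_prod, Circle.norm_coe]

theorem bddAbove_torus (P : MvPolynomial σ K) :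
    BddAbove (Set.range fun z : σ → Circle => ‖MvPolynomial.eval₂ τ (fun i => (z i : ℂ)) P‖) :=
  ⟨_, by rintro _ ⟨z, rfl⟩; exact norm_eval₂_circle_le τ P z⟩

theorem norm_eval₂_le_torusNorm (P : MvPolynomial σ K) (z : σ → Circle) :
    ‖MvPolynomial.eval₂ τ (fun i => (z i : ℂ)) P‖ ≤ torusNorm τ P :=
  le_ciSup (f := fun z : σ → Circle => ‖MvPolynomial.eval₂ τ (fun i => (z i : ℂ)) P‖)
    (bddAbove_torus τ P) z

/-- This norm replaces the largest coefficient, which is not power-multiplicative for an archimedean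
absolute value. A supremum of absolute values of evaluations is, since taking powers of nonnegative
reals commutes with suprema. -/
theorem isPowNorm_torusNorm :
    IsPowNorm (R := MvPolynomial σ K) (fun c => ‖τ c‖) (torusNorm τ) where
  nonneg := torusNorm_nonneg τ
  map_zero := by simp [torusNorm]
  add_le P Q := ciSup_le fun z => by
    rw [MvPolynomial.eval₂_add]
    exact (norm_add_le _ _).trans
      (add_le_add (norm_eval₂_le_torusNorm τ P z) (norm_eval₂_le_torusNorm τ Q z))
  mul_le P Q := ciSup_le fun z => by
    rw [MvPolynomial.eval₂_mul, norm_mul]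
    exact mul_le_mul (norm_eval₂_le_torusNorm τ P z) (norm_eval₂_le_torusNorm τ Q z)
      (norm_nonneg _) (torusNorm_nonneg τ P)
  map_pow P n := by
    simp only [torusNorm, MvPolynomial.eval₂_pow, norm_pow]
    exact (Real.iSup_pow (fun _ => norm_nonneg _) n).symm
  map_algebraMap c := by
    simp [torusNorm, MvPolynomial.algebraMap_eq]

theorem torusNorm_le (P : MvPolynomial σ K) :
    torusNorm τ P ≤ ∑ s ∈ P.support, ‖τ (P.coeff s)‖ :=
  ciSup_le fun z => norm_eval₂_circle_le τ P z

/-- Orthogonality of the characters of the group of `N`-th roots of unity; exponents below `N` give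
distinct characters. -/
theorem sum_root_pow {N : ℕ} {ω : ℂ} (hω : IsPrimitiveRoot ω N) {a b : ℕ}
    (ha : a < N) (hb : b < N) :
    ∑ k ∈ Finset.range N, (ω ^ k) ^ a * ((ω ^ k) ^ b)⁻¹ = if a = b then (N : ℂ) else 0 := by
  have hN : 0 < N := by omega
  have hω0 : ω ≠ 0 := hω.ne_zero hN.ne'
  have hterm : ∀ k, (ω ^ k) ^ a * ((ω ^ k) ^ b)⁻¹ = (ω ^ a * (ω ^ b)⁻¹) ^ k := fun k => by
    rw [mul_pow, inv_pow, ← pow_mul, ← pow_mul, ← pow_mul, ← pow_mul, mul_comm k, mul_comm k]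
  simp only [hterm]
  split_ifs with hab
  · subst hab
    simp [mul_inv_cancel₀ (pow_ne_zero a hω0)]
  · have hne : ω ^ a * (ω ^ b)⁻¹ - 1 ≠ 0 := fun h => by
      rw [sub_eq_zero, mul_inv_eq_one₀ (pow_ne_zero b hω0)] at h
      exact hab (hω.pow_inj ha hb h)
    have := geom_sum_mul (ω ^ a * (ω ^ b)⁻¹) N
    rw [mul_pow, inv_pow, ← pow_mul, ← pow_mul, mul_comm a, mul_comm b, pow_mul, pow_mul,
      hω.pow_eq_one, one_pow, one_pow, inv_one, mul_one, sub_self] at this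
    exact (mul_eq_zero.mp this).resolve_right hne

/-- Cauchy's estimate: coefficients are bounded by the maximum on the unit torus. -/
theorem norm_coeff_le_torusNorm [DecidableEq σ] (P : MvPolynomial σ K) (t : σ →₀ ℕ) :
    ‖τ (P.coeff t)‖ ≤ torusNorm τ P := by
  by_cases htP : t ∈ P.support
  swap
  · rw [MvPolynomial.notMem_support_iff.mp htP]
    simpa using torusNorm_nonneg τ P
  -- `N` exceeds every exponent of every variable, so averaging over `N`-th roots of unity, a finite
  -- Fourier inversion, isolates the coefficient of index `t`.
  set N := P.totalDegree + 1 with hN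
  have hlt : ∀ s ∈ P.support, ∀ i, s i < N := fun s hs i => by
    have h1 := MvPolynomial.le_totalDegree hs
    have h2 : s i ≤ s.sum fun _ e => e := by
      by_cases hi : i ∈ s.support
      · exact Finset.single_le_sum (f := fun i => s i) (fun _ _ => Nat.zero_le _) hi
      · rw [Finsupp.notMem_support_iff.mp hi]; exact Nat.zero_le _
    omega
  have hω : IsPrimitiveRoot (Complex.exp (2 * Real.pi * Complex.I / N)) N :=
    Complex.isPrimitiveRoot_exp N (by omega)
  set ω := Complex.exp (2 * Real.pi * Complex.I / N) with hωdef
  have hω1 : ‖ω‖ = 1 := hω.norm'_eq_one (by omega)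
  let ζ : Circle := ⟨ω, by simpa [Submonoid.unitSphere] using hω1⟩
  have hζ : (ζ : ℂ) = ω := rfl
  have hsum : ∑ k ∈ Fintype.piFinset (fun _ : σ => Finset.range N),
      MvPolynomial.eval₂ τ (fun i => ((ζ ^ k i : Circle) : ℂ)) P * ∏ i, ((ω ^ k i) ^ t i)⁻¹ =
      (N : ℂ) ^ Fintype.card σ * τ (P.coeff t) := by
    have h1 : ∀ k : σ → ℕ, MvPolynomial.eval₂ τ (fun i => ((ζ ^ k i : Circle) : ℂ)) P *
        ∏ i, ((ω ^ k i) ^ t i)⁻¹ = ∑ s ∈ P.support, τ (P.coeff s) *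
          ∏ i, ((ω ^ k i) ^ s i * ((ω ^ k i) ^ t i)⁻¹) := fun k => by
      rw [MvPolynomial.eval₂_eq', Finset.sum_mul]
      refine Finset.sum_congr rfl fun s _ => ?_
      rw [Finset.prod_mul_distrib, mul_assoc]
      simp [hζ]
    simp only [h1]
    rw [Finset.sum_comm]
    have h2 : ∀ s ∈ P.support, ∑ k ∈ Fintype.piFinset (fun _ : σ => Finset.range N),
        τ (P.coeff s) * ∏ i, ((ω ^ k i) ^ s i * ((ω ^ k i) ^ t i)⁻¹) =
        if s = t then (N : ℂ) ^ Fintype.card σ * τ (P.coeff t) else 0 := fun s hs => by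
      rw [← Finset.mul_sum, ← Finset.prod_univ_sum (fun _ : σ => Finset.range N)
        (fun i k => (ω ^ k) ^ s i * ((ω ^ k) ^ t i)⁻¹)]
      simp only [sum_root_pow hω (hlt s hs _) (hlt t htP _)]
      split_ifs with hst
      · subst hst
        simp [mul_comm]
      · obtain ⟨i, hi⟩ : ∃ i, s i ≠ t i := by
          by_contra! hcon
          exact hst (Finsupp.ext hcon)
        rw [Finset.prod_eq_zero (Finset.mem_univ i) (if_neg hi), mul_zero]
    rw [Finset.sum_congr rfl h2, Finset.sum_ite_eq' P.support t, if_pos htP]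
  have hnorm := congrArg norm hsum
  rw [norm_mul, norm_pow, Complex.norm_natCast] at hnorm
  have hle : (N : ℝ) ^ Fintype.card σ * ‖τ (P.coeff t)‖ ≤
      (N : ℝ) ^ Fintype.card σ * torusNorm τ P := by
    rw [← hnorm]
    refine (norm_sum_le _ _).trans ?_
    calc _ ≤ ∑ k ∈ Fintype.piFinset (fun _ : σ => Finset.range N), torusNorm τ P := by
          refine Finset.sum_le_sum fun k _ => ?_
          rw [norm_mul]
          have : ‖∏ i, ((ω ^ k i) ^ t i)⁻¹‖ = 1 := by simp [norm_prod, hω1]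
          rw [this, mul_one]
          exact norm_eval₂_le_torusNorm τ P fun i => ζ ^ k i
      _ = _ := by simp
  exact le_of_mul_le_mul_left hle (by positivity)

end TorusNorm

/-! ### Number of monomials, and Tate's telescoping argument -/

theorem card_support_le {K : Type*} [Field K] {m D : ℕ} {P : MvPolynomial (Fin (m + 1)) K}
    (hP : P.IsHomogeneous D) : P.support.card ≤ (D + 1) ^ (m + 1) := by
  calc P.support.card
      ≤ (Fintype.piFinset fun _ : Fin (m + 1) => Finset.range (D + 1)).card := by
        refine Finset.card_le_card_of_injOn (fun s i => s i) (fun s hs => ?_)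
          (fun s _ t _ h => DFunLike.coe_injective h)
        refine Finset.mem_coe.mpr (Fintype.mem_piFinset.mpr fun i => ?_)
        rw [Finset.mem_range, ← sum_eq_of_mem_support hP hs, Nat.lt_succ_iff]
        exact Finset.single_le_sum (f := fun i => s i) (fun _ _ => Nat.zero_le _)
          (Finset.mem_univ i)
    _ = _ := by simp

/-- Tate's telescoping argument: `log (a i) / d ^ i` converges if `a (i + 1)` is comparable to
`a i ^ d`. -/
theorem exists_tendsto_log_div_pow {d : ℕ} (hd : 2 ≤ d) {C : ℝ} (hC : 1 ≤ C) {a : ℕ → ℝ}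
    (ha : ∀ i, 0 < a i) (h₁ : ∀ i, a (i + 1) ≤ C * a i ^ d) (h₂ : ∀ i, a i ^ d ≤ C * a (i + 1)) :
    ∃ L, Tendsto (fun i => Real.log (a i) / (d : ℝ) ^ i) atTop (𝓝 L) ∧
      ∀ i, |Real.log (a i) / (d : ℝ) ^ i - L| ≤ Real.log C * (1 / (d : ℝ)) ^ i := by
  have hd' : (2 : ℝ) ≤ d := by exact_mod_cast hd
  have hC0 : 0 < C := by linarith
  have hlC : 0 ≤ Real.log C := Real.log_nonneg hC
  have hr : 1 / (d : ℝ) < 1 := by rw [div_lt_one (by linarith)]; linarith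
  -- The two comparisons say that `log (a (i + 1))` and `d * log (a i)` differ by at most `log C`;
  -- divide by `d ^ (i + 1)`.
  have hstep : ∀ i, dist (Real.log (a i) / (d : ℝ) ^ i) (Real.log (a (i + 1)) / (d : ℝ) ^ (i + 1)) ≤
      Real.log C / d * (1 / (d : ℝ)) ^ i := fun i => by
    have e1 := Real.log_le_log (ha _) (h₁ i)
    have e2 := Real.log_le_log (pow_pos (ha _) _) (h₂ i)
    rw [Real.log_mul hC0.ne' (pow_pos (ha _) _).ne', Real.log_pow] at e1
    rw [Real.log_mul hC0.ne' (ha _).ne', Real.log_pow] at e2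
    have hp : (0 : ℝ) < (d : ℝ) ^ (i + 1) := by positivity
    have e3 : Real.log (a i) / (d : ℝ) ^ i - Real.log (a (i + 1)) / (d : ℝ) ^ (i + 1) =
        (d * Real.log (a i) - Real.log (a (i + 1))) / (d : ℝ) ^ (i + 1) := by
      rw [pow_succ]
      field_simp
    have e4 : Real.log C / d * (1 / (d : ℝ)) ^ i = Real.log C / (d : ℝ) ^ (i + 1) := by
      rw [one_div, inv_pow, pow_succ]
      field_simp
    rw [Real.dist_eq, e3, e4, abs_div, abs_of_pos hp]
    gcongr
    rw [abs_le]
    constructor <;> linarith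
  obtain ⟨L, hL⟩ := cauchySeq_tendsto_of_complete (cauchySeq_of_le_geometric _ _ hr hstep)
  refine ⟨L, hL, fun i => ?_⟩
  have := dist_le_of_le_geometric_of_tendsto _ _ hr hstep hL i
  rw [Real.dist_eq] at this
  refine this.trans ?_
  have h1 : (0 : ℝ) < 1 - 1 / d := by linarith
  rw [div_le_iff₀ h1]
  -- As `d ≥ 2`, one has `1 / d ≤ 1 - 1 / d`, which absorbs the denominator of the geometric tail.
  have h2 : Real.log C / d ≤ Real.log C * (1 - 1 / d) := by
    have h3 : 1 / (d : ℝ) ≤ 1 / 2 := one_div_le_one_div_of_le (by norm_num) hd'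
    rw [div_eq_mul_one_div]
    gcongr
    linarith
  calc Real.log C / d * (1 / (d : ℝ)) ^ i ≤ Real.log C * (1 - 1 / d) * (1 / (d : ℝ)) ^ i := by
        gcongr
    _ = _ := by ring

/-! ### Iterated composition and homogeneity of lifts -/

section Lifts

variable {K : Type*} [Field K] {m M : ℕ}

theorem ProjLift.iterate_comp_deg (F : ProjLift K M M) (G : ProjLift K m M) (i : ℕ) :
    (F.comp^[i] G).deg = F.deg ^ i * G.deg := by
  induction i with
  | zero => simp
  | succ i ih =>
    rw [Function.iterate_succ_apply', pow_succ']
    change F.deg * _ = _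
    rw [ih, mul_assoc]

theorem ProjLift.iterate_comp_eval {L : Type*} [Field L] [Algebra K L] (F : ProjLift K M M)
    (G : ProjLift K m M) (i : ℕ) (z : Fin (m + 1) → L) :
    (F.comp^[i] G).eval z = F.eval^[i] (G.eval z) := by
  induction i with
  | zero => simp
  | succ i ih =>
    rw [Function.iterate_succ_apply', Function.iterate_succ_apply', ← ih]
    funext j
    exact MvPolynomial.aeval_bind₁ _ _ _

theorem ProjLift.exists_form_ne_zero (F : ProjLift K m M) : ∃ j, F.form j ≠ 0 := by
  by_contra! h
  have := F.eq_zero_of_common_zero (fun _ => 1) fun j => by simp [h j]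
  exact one_ne_zero (congrFun this 0)

theorem iterate_comp_equiv {f : ProjMorphism K M M} {F : ProjLift K M M} (hF : f.IsLift F)
    {g : ProjMorphism K m M} {G : ProjLift K m M} (hG : g.IsLift G) (i : ℕ) :
    (f.comp^[i] g).IsLift (F.comp^[i] G) := by
  induction i with
  | zero => exact hG
  | succ i ih =>
    rw [Function.iterate_succ_apply', Function.iterate_succ_apply', ← ih, ← hF]
    rfl

theorem ProjLift.eval_smul {L : Type*} [Field L] [Algebra K L] (F : ProjLift K m M) (t : L)
    (x : Fin (m + 1) → L) : F.eval (t • x) = t ^ F.deg • F.eval x := by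
  funext k
  simp only [ProjLift.eval, Pi.smul_apply, smul_eq_mul, aeval_eq_sum_of_fintype, Finset.mul_sum]
  refine Finset.sum_congr rfl fun s hs => ?_
  rw [← sum_eq_of_mem_support (F.isHomogeneous k) hs]
  simp only [mul_pow, Finset.prod_mul_distrib, Finset.prod_pow_eq_pow_sum]
  ring

theorem ProjLift.iterate_eval_smul {L : Type*} [Field L] [Algebra K L] (F : ProjLift K M M) (t : L)
    (x : Fin (M + 1) → L) (i : ℕ) : F.eval^[i] (t • x) = t ^ F.deg ^ i • F.eval^[i] x := by
  induction i with
  | zero => simp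
  | succ i ih =>
    rw [Function.iterate_succ_apply', ih, F.eval_smul, ← pow_mul, ← pow_succ,
      Function.iterate_succ_apply']

theorem ProjLift.eval_zero {L : Type*} [Field L] [Algebra K L] (F : ProjLift K m M)
    (hd : 1 ≤ F.deg) : F.eval (0 : Fin (m + 1) → L) = 0 := by
  have := F.eval_smul (0 : L) 0
  rwa [smul_zero, zero_pow (by omega), zero_smul] at this

end Lifts

/-! ### Green's functions over a field with absolute value -/

section LocalField

variable {K L : Type*} [Field K] [Field L] [Algebra K L] {w : K → ℝ} {abv : L → ℝ} {m M : ℕ}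

/-- A default value: the iterates stay at the origin and `Real.log 0 = 0`. It places the origin in
`greenDomain`. -/
theorem green_zero {F : ProjLift K M M} (hd : 1 ≤ F.deg) (h0 : abv 0 = 0) :
    green abv F 0 = 0 := by
  have hit : ∀ i, F.eval^[i] (0 : Fin (M + 1) → L) = 0 := fun i =>
    Function.iterate_fixed (F.eval_zero hd) i
  refine Tendsto.limUnder_eq ?_
  simp [hit, tupleAbs, h0]

theorem IsPowNorm.tupleAbs_pos (hν : IsPowNorm w abv) (h0 : ∀ x, abv x = 0 → x = 0)
    {x : Fin (m + 1) → L} (hx : x ≠ 0) : 0 < tupleAbs abv x := by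
  obtain ⟨j, hj⟩ := Function.ne_iff.mp hx
  exact ((hν.nonneg _).lt_of_ne fun h => hj (h0 _ h.symm)).trans_le (IsPowNorm.le_iSup x j)

/-- A lift has no nontrivial zero over `AlgebraicClosure K` by definition; over `L` the lower bound
for `|F(x)|` excludes one. -/
theorem IsPowNorm.eval_ne_zero (hν : IsPowNorm w abv) (h0 : ∀ x, abv x = 0 → x = 0)
    (F : ProjLift K m M) (hd : 1 ≤ F.deg) {x : Fin (m + 1) → L} (hx : x ≠ 0) : F.eval x ≠ 0 := by
  obtain ⟨C, hC, h⟩ := hν.exists_eval_bounds F hd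
  intro hzero
  have h2 := (h x).2
  have hz : ∀ k, MvPolynomial.aeval x (F.form k) = 0 := fun k => congrFun hzero k
  simp only [hz, hν.map_zero, ciSup_const, mul_zero] at h2
  exact absurd h2 (not_le.mpr (pow_pos (hν.tupleAbs_pos h0 hx) _))

/-- The Green's function exists, with a uniform rate of convergence. -/
theorem IsPowNorm.exists_green_bound (hν : IsPowNorm w abv) (h0 : ∀ x, abv x = 0 → x = 0)
    (F : ProjLift K M M) (hd : 2 ≤ F.deg) :
    ∃ B : ℝ, ∀ x : Fin (M + 1) → L, x ≠ 0 →
      Tendsto (fun i : ℕ => Real.log (tupleAbs abv (F.eval^[i] x)) / (F.deg : ℝ) ^ i) atTop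
        (𝓝 (green abv F x)) ∧
      ∀ i, |Real.log (tupleAbs abv (F.eval^[i] x)) / (F.deg : ℝ) ^ i - green abv F x| ≤
        B * (1 / (F.deg : ℝ)) ^ i := by
  obtain ⟨C, hC, h⟩ := hν.exists_eval_bounds F (by omega)
  refine ⟨Real.log C, fun x hx => ?_⟩
  have hne : ∀ i, F.eval^[i] x ≠ 0 := fun i => by
    induction i with
    | zero => exact hx
    | succ i ih =>
      rw [Function.iterate_succ_apply']
      exact hν.eval_ne_zero h0 F (by omega) ih
  obtain ⟨l, hl, hb⟩ := exists_tendsto_log_div_pow hd hC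
    (a := fun i => tupleAbs abv (F.eval^[i] x)) (fun i => hν.tupleAbs_pos h0 (hne i))
    (fun i => by
      rw [Function.iterate_succ_apply']
      exact (h _).1)
    (fun i => by
      rw [Function.iterate_succ_apply']
      exact (h _).2)
  have hg : green abv F x = l := hl.limUnder_eq
  rw [hg]
  exact ⟨hl, hb⟩

theorem tupleAbs_smul (hmul : ∀ x y, abv (x * y) = abv x * abv y) (hnn : ∀ x, 0 ≤ abv x) (t : L)
    (x : Fin (m + 1) → L) : tupleAbs abv (t • x) = abv t * tupleAbs abv x := by
  simp only [tupleAbs, Pi.smul_apply, smul_eq_mul, hmul, Real.mul_iSup_of_nonneg (hnn _)]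

theorem IsPowNorm.green_smul (hν : IsPowNorm w abv) (hmul : ∀ x y, abv (x * y) = abv x * abv y)
    (h0 : ∀ x, abv x = 0 → x = 0) (F : ProjLift K M M) (hd : 2 ≤ F.deg) {t : L} (ht : t ≠ 0)
    {x : Fin (M + 1) → L} (hx : x ≠ 0) :
    green abv F (t • x) = Real.log (abv t) + green abv F x := by
  obtain ⟨B, hB⟩ := hν.exists_green_bound h0 F hd
  have hdp : ∀ i, (0 : ℝ) < (F.deg : ℝ) ^ i := fun i => by
    have : 0 < F.deg := by omega
    positivity
  refine tendsto_nhds_unique (hB _ (smul_ne_zero ht hx)).1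
    (((hB x hx).1.const_add (Real.log (abv t))).congr fun i => ?_)
  have hne : F.eval^[i] x ≠ 0 := by
    clear hB
    induction i with
    | zero => exact hx
    | succ i ih =>
      rw [Function.iterate_succ_apply']
      exact hν.eval_ne_zero h0 F (by omega) ih
  rw [F.iterate_eval_smul, tupleAbs_smul hmul hν.nonneg, hν.map_pow,
    Real.log_mul (pow_ne_zero _ fun h => ht (h0 _ h)) (hν.tupleAbs_pos h0 hne).ne', Real.log_pow,
    add_div, Nat.cast_pow, mul_div_cancel_left₀ _ (hdp i).ne']

/-- `𝓖 ∘ G` is comparable to `deg G * log |z|`. -/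
theorem IsPowNorm.exists_green_eval_bound (hν : IsPowNorm w abv) (h0 : ∀ x, abv x = 0 → x = 0)
    (F : ProjLift K M M) (hd : 2 ≤ F.deg) (G : ProjLift K m M) (he : 1 ≤ G.deg) :
    ∃ B : ℝ, ∀ z : Fin (m + 1) → L, z ≠ 0 →
      |green abv F (G.eval z) - G.deg * Real.log (tupleAbs abv z)| ≤ B := by
  obtain ⟨B, hB⟩ := hν.exists_green_bound h0 F hd
  obtain ⟨C, hC, h⟩ := hν.exists_eval_bounds G he
  refine ⟨B + Real.log C, fun z hz => ?_⟩
  have hGz := hν.eval_ne_zero h0 G he hz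
  -- The rate of convergence at `i = 0` compares `𝓖 (G z)` with `log |G z|`, which the bounds for
  -- `G` compare with `e log |z|`.
  have h1 := (hB _ hGz).2 0
  simp only [Function.iterate_zero, id, pow_zero, div_one, mul_one] at h1
  have hp := hν.tupleAbs_pos h0 hz
  have hpG := hν.tupleAbs_pos h0 hGz
  have e1 : Real.log (tupleAbs abv (G.eval z)) ≤ Real.log (C * tupleAbs abv z ^ G.deg) :=
    Real.log_le_log hpG (h z).1
  have e2 : Real.log (tupleAbs abv z ^ G.deg) ≤ Real.log (C * tupleAbs abv (G.eval z)) :=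
    Real.log_le_log (pow_pos hp _) (h z).2
  rw [Real.log_mul (by positivity) (pow_pos hp G.deg).ne', Real.log_pow] at e1
  rw [Real.log_mul (by positivity) hpG.ne', Real.log_pow] at e2
  rw [abs_le] at h1 ⊢
  constructor <;> linarith [h1.1, h1.2]

/-- Convergence of the normalized logarithms of the composed lifts. -/
theorem IsPowNorm.exists_green_comp_bound (hν : IsPowNorm w abv) (h0 : ∀ x, abv x = 0 → x = 0)
    (F : ProjLift K M M) (hd : 2 ≤ F.deg) (G : ProjLift K m M) (he : 1 ≤ G.deg) :
    ∃ B : ℝ, ∀ z : Fin (m + 1) → L, z ≠ 0 → ∀ i,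
      |Real.log (tupleAbs abv ((F.comp^[i] G).eval z)) / (F.deg : ℝ) ^ i -
        green abv F (G.eval z)| ≤ B * (1 / (F.deg : ℝ)) ^ i := by
  obtain ⟨B, hB⟩ := hν.exists_green_bound h0 F hd
  refine ⟨B, fun z hz i => ?_⟩
  rw [ProjLift.iterate_comp_eval]
  exact (hB _ (hν.eval_ne_zero h0 G he hz)).2 i

end LocalField

/-! ### Convergence of the normalized coefficient norms -/

section Coefficients

variable {K L : Type*} [Field K] [Field L] [Algebra K L] (w : AbsoluteValue K ℝ) {abv : L → ℝ}
  {m M : ℕ}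

theorem coeffAbs_eq_iSup_gaussNorm (hw : ∀ c, abv (algebraMap K L c) = w c) (F : ProjLift K m M) :
    F.coeffAbs abv = ⨆ j, gaussNorm w (F.form j) := by
  simp only [ProjLift.coeffAbs, ProjLift.coeffs, hw]
  refine le_antisymm ?_ ?_
  · refine Real.iSup_le (fun p => ?_) (Real.iSup_nonneg fun j => gaussNorm_nonneg w _)
    exact (abv_coeff_le_gaussNorm w _ _).trans
      (IsPowNorm.le_iSup (ν := gaussNorm w) (fun j => F.form j) p.1)
  · refine ciSup_le fun j => gaussNorm_le w fun s => ?_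
    by_cases hs : (F.form j).coeff s = 0
    · rw [hs, w.map_zero]
      exact Real.iSup_nonneg fun _ => w.nonneg _
    · have hmem : s ∈ Finset.finsuppAntidiag (Finset.univ : Finset (Fin (m + 1))) F.deg := by
        rw [Finset.mem_finsuppAntidiag]
        exact ⟨sum_eq_of_mem_support (F.isHomogeneous j) (MvPolynomial.mem_support_iff.mpr hs),
          Finset.subset_univ _⟩
      exact le_ciSup (f := fun p : Fin (M + 1) ×
        (Finset.finsuppAntidiag (Finset.univ : Finset (Fin (m + 1))) F.deg) =>
          w ((F.form p.1).coeff p.2)) (Set.finite_range _).bddAbove (j, ⟨s, hmem⟩)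

theorem coeffAbs_pos (hw : ∀ c, abv (algebraMap K L c) = w c) (F : ProjLift K m M) :
    0 < F.coeffAbs abv := by
  obtain ⟨j, hj⟩ := F.exists_form_ne_zero
  rw [coeffAbs_eq_iSup_gaussNorm w hw]
  exact (gaussNorm_pos w hj).trans_le (IsPowNorm.le_iSup (ν := gaussNorm w) F.form j)

/-- The torus norm and the largest coefficient differ at most by a factor polynomial in the degree
`d ^ i * e`. Its logarithm grows linearly in `i`, hence is negligible against `d ^ i`. -/
theorem tendsto_log_pow_div_pow {d : ℕ} (hd : 2 ≤ d) (e k : ℕ) :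
    Tendsto (fun i : ℕ => Real.log (((d ^ i * e + 1 : ℕ) : ℝ) ^ k) / (d : ℝ) ^ i) atTop (𝓝 0) := by
  have hd1 : (1 : ℝ) < d := by exact_mod_cast hd
  have h1 : Tendsto (fun i : ℕ => k * (Real.log (e + 1) * ((i : ℝ) ^ 0 / (d : ℝ) ^ i) +
      Real.log d * ((i : ℝ) ^ 1 / (d : ℝ) ^ i))) atTop (𝓝 (k * (Real.log (e + 1) * 0 +
        Real.log d * 0))) :=
    (((tendsto_pow_const_div_const_pow_of_one_lt 0 hd1).const_mul _).add
      ((tendsto_pow_const_div_const_pow_of_one_lt 1 hd1).const_mul _)).const_mul _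
  rw [mul_zero, mul_zero, add_zero, mul_zero] at h1
  refine squeeze_zero (fun i => ?_) (fun i => ?_) h1
  · refine div_nonneg (Real.log_nonneg (one_le_pow₀ ?_)) (by positivity)
    push_cast
    linarith [show (0 : ℝ) ≤ (d : ℝ) ^ i * e by positivity]
  · have hdi : (1 : ℝ) ≤ (d : ℝ) ^ i := one_le_pow₀ hd1.le
    -- This comes from `d ^ i * e + 1 ≤ (e + 1) * d ^ i`.
    have h2 : Real.log ((d ^ i * e + 1 : ℕ) : ℝ) ≤ Real.log (e + 1) + i * Real.log d := by
      rw [← Real.log_pow, ← Real.log_mul (by positivity) (by positivity)]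
      refine Real.log_le_log (by positivity) ?_
      push_cast
      nlinarith
    rw [Real.log_pow, div_le_iff₀ (by positivity)]
    calc (k : ℝ) * Real.log ((d ^ i * e + 1 : ℕ) : ℝ)
        ≤ k * (Real.log (e + 1) + i * Real.log d) := by gcongr
      _ = _ := by
        field_simp

/-- Existence and positivity of `lim |F^i ∘ G|^(1/d^i)`, given a power-multiplicative norm on
polynomials that is comparable to the Gauss norm up to a factor polynomial in the degree. -/
theorem tendsto_hatAbs (hw : ∀ c, abv (algebraMap K L c) = w c)
    {ν : MvPolynomial (Fin (m + 1)) K → ℝ} (hν : IsPowNorm w ν)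
    (hle : ∀ P, gaussNorm w P ≤ ν P)
    (hge : ∀ P D, MvPolynomial.IsHomogeneous P D →
      ν P ≤ ((D + 1 : ℕ) : ℝ) ^ (m + 1) * gaussNorm w P)
    (F : ProjLift K M M) (hd : 2 ≤ F.deg) (G : ProjLift K m M) :
    0 < hatAbs abv F G ∧
      Tendsto (fun i : ℕ => (F.comp^[i] G).coeffAbs abv ^ (1 / (F.deg : ℝ) ^ i))
        atTop (𝓝 (hatAbs abv F G)) := by
  obtain ⟨C, hC, h⟩ := hν.exists_eval_bounds F (by omega)
  set Φ : ℕ → ProjLift K m M := fun i => F.comp^[i] G with hΦ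
  set a : ℕ → ℝ := fun i => ⨆ j, ν ((Φ i).form j) with ha
  have hba : ∀ i, (Φ i).coeffAbs abv ≤ a i := fun i => by
    rw [coeffAbs_eq_iSup_gaussNorm w hw]
    exact ciSup_le fun j => (hle _).trans (IsPowNorm.le_iSup (Φ i).form j)
  have hab : ∀ i, a i ≤ ((F.deg ^ i * G.deg + 1 : ℕ) : ℝ) ^ (m + 1) * (Φ i).coeffAbs abv :=
    fun i => by
      rw [coeffAbs_eq_iSup_gaussNorm w hw]
      refine ciSup_le fun j => (hge _ _ ((Φ i).isHomogeneous j)).trans ?_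
      rw [← F.iterate_comp_deg G i]
      exact mul_le_mul_of_nonneg_left (IsPowNorm.le_iSup (ν := gaussNorm w) (Φ i).form j)
        (by positivity)
  have hbpos : ∀ i, 0 < (Φ i).coeffAbs abv := fun i => coeffAbs_pos w hw _
  have hapos : ∀ i, 0 < a i := fun i => (hbpos i).trans_le (hba i)
  -- The forms of `Φ i` are the coordinates of a point over the polynomial ring, and `F` maps this
  -- point to the next one; so the bounds for values of `F` apply to `a`.
  have hsucc : ∀ i, (Φ (i + 1)).form = fun j => MvPolynomial.aeval (Φ i).form (F.form j) :=
    fun i => by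
      simp only [hΦ, Function.iterate_succ_apply']
      rfl
  obtain ⟨l, hl, -⟩ := exists_tendsto_log_div_pow hd hC hapos
    (fun i => by
      simp only [ha, hsucc]
      exact (h _).1)
    (fun i => by
      simp only [ha, hsucc]
      exact (h _).2)
  have hdp : ∀ i, (0 : ℝ) < (F.deg : ℝ) ^ i := fun i => by
    have : 0 < F.deg := by omega
    positivity
  have hlog : Tendsto (fun i => Real.log ((Φ i).coeffAbs abv) / (F.deg : ℝ) ^ i) atTop (𝓝 l) := by
    have hlow := hl.sub (tendsto_log_pow_div_pow hd G.deg (m + 1))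
    rw [sub_zero] at hlow
    refine tendsto_of_tendsto_of_tendsto_of_le_of_le hlow hl (fun i => ?_) fun i => ?_
    · have h1 := Real.log_le_log (hapos i) (hab i)
      rw [Real.log_mul (by positivity) (hbpos i).ne'] at h1
      have h2 := div_le_div_of_nonneg_right h1 (hdp i).le
      rw [add_div] at h2
      simp only
      linarith
    · exact div_le_div_of_nonneg_right (Real.log_le_log (hbpos i) (hba i)) (hdp i).le
  have hexp : Tendsto (fun i : ℕ => (F.comp^[i] G).coeffAbs abv ^ (1 / (F.deg : ℝ) ^ i))
      atTop (𝓝 (Real.exp l)) := by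
    refine ((Real.continuous_exp.tendsto l).comp hlog).congr fun i => ?_
    rw [Function.comp_apply, Real.rpow_def_of_pos (hbpos i), mul_one_div]
  have hhat : hatAbs abv F G = Real.exp l := hexp.limUnder_eq
  rw [hhat]
  exact ⟨Real.exp_pos l, hexp⟩

end Coefficients

/-! ### Exact formulas at places of good reduction -/

section GoodReduction

variable {K L : Type*} [Field K] [Field L] [Algebra K L] {w : AbsoluteValue K ℝ} {abv : L → ℝ}
  {m M : ℕ}

/-- The forms of `F^i ∘ G` arise from the tuple of variables, of Gauss norm one, by applying `G` and
then `F` repeatedly; under good reduction each application only raises the norm to a power. -/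
theorem coeffAbs_eq_one_of_hasGoodReduction (hw : ∀ c, abv (algebraMap K L c) = w c)
    (hna : IsNonarchimedean w) {F : ProjLift K M M} (hF : F.HasGoodReduction w) (hd : 1 ≤ F.deg)
    {G : ProjLift K m M} (hG : G.HasGoodReduction w) (he : 1 ≤ G.deg) (i : ℕ) :
    (F.comp^[i] G).coeffAbs abv = 1 := by
  have hν := isPowNorm_gaussNorm (σ := Fin (m + 1)) w hna
  have hna' := isNonarchimedean_gaussNorm (σ := Fin (m + 1)) w hna
  rw [coeffAbs_eq_iSup_gaussNorm w hw]
  induction i with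
  | zero =>
    have h1 := hν.iSup_eval_eq hna' he hG MvPolynomial.X
    have hX : ∀ j : Fin (m + 1), gaussNorm w (MvPolynomial.X j : MvPolynomial (Fin (m + 1)) K) = 1 :=
      fun j => by
        refine le_antisymm (gaussNorm_le w fun s => ?_) ?_
        · rw [MvPolynomial.coeff_X]
          split_ifs <;> simp
        · simpa using abv_coeff_le_gaussNorm w
            (MvPolynomial.X j : MvPolynomial (Fin (m + 1)) K) (Finsupp.single j 1)
    simpa [hX] using h1
  | succ i ih =>
    have h1 := hν.iSup_eval_eq hna' hd hF (F.comp^[i] G).form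
    rw [ih, one_pow] at h1
    rw [Function.iterate_succ_apply']
    exact h1

theorem tupleAbs_iterate_comp_eval (hν : IsPowNorm w abv) (hna : IsNonarchimedean abv)
    {F : ProjLift K M M} (hF : F.HasGoodReduction w) (hd : 1 ≤ F.deg)
    {G : ProjLift K m M} (hG : G.HasGoodReduction w) (he : 1 ≤ G.deg) (i : ℕ)
    (z : Fin (m + 1) → L) :
    tupleAbs abv ((F.comp^[i] G).eval z) = tupleAbs abv z ^ (F.comp^[i] G).deg := by
  rw [ProjLift.iterate_comp_eval, ProjLift.iterate_comp_deg]
  induction i with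
  | zero => simpa [tupleAbs, ProjLift.eval] using hν.iSup_eval_eq hna he hG z
  | succ i ih =>
    rw [Function.iterate_succ_apply', pow_succ, mul_right_comm, pow_mul, ← ih]
    exact hν.iSup_eval_eq hna hd hF _

theorem green_of_hasGoodReduction (hν : IsPowNorm w abv) (hna : IsNonarchimedean abv)
    {F : ProjLift K M M} (hF : F.HasGoodReduction w) (hd : 2 ≤ F.deg)
    {G : ProjLift K m M} (hG : G.HasGoodReduction w) (he : 1 ≤ G.deg) (z : Fin (m + 1) → L) :
    green abv F (G.eval z) = G.deg * Real.log (tupleAbs abv z) := by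
  refine Tendsto.limUnder_eq ?_
  have hdp : ∀ i, (0 : ℝ) < (F.deg : ℝ) ^ i := fun i => by
    have : 0 < F.deg := by omega
    positivity
  refine tendsto_const_nhds.congr fun i => ?_
  rw [← ProjLift.iterate_comp_eval, tupleAbs_iterate_comp_eval hν hna hF (by omega) hG he,
    Real.log_pow, ProjLift.iterate_comp_deg, Nat.cast_mul, Nat.cast_pow, mul_assoc,
    mul_div_cancel_left₀ _ (hdp i).ne']

end GoodReduction

theorem rpow_one_div_pow_mul {x : ℝ} (hx : 0 < x) (d e i : ℕ) :
    x ^ (1 / (((d ^ i * e : ℕ) : ℝ))) = Real.exp (Real.log x / (d : ℝ) ^ i / e) := by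
  rw [Real.rpow_def_of_pos hx, Nat.cast_mul, Nat.cast_pow, mul_one_div, div_div]

theorem continuous_projLift_eval {K L : Type*} [Field K] [Field L] [Algebra K L]
    [TopologicalSpace L] [IsTopologicalRing L] {m M : ℕ} (F : ProjLift K m M) :
    Continuous fun z : Fin (m + 1) → L => F.eval z := by
  refine continuous_pi fun k => ?_
  simp only [ProjLift.eval, aeval_eq_sum_of_fintype]
  fun_prop

theorem tendsto_log_coeffAbs {K L : Type*} [Field K] [Field L] [Algebra K L] {abv : L → ℝ}
    {m M : ℕ} {F : ProjLift K M M} {G : ProjLift K m M}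
    (hpos : ∀ i, 0 < (F.comp^[i] G).coeffAbs abv)
    (h : 0 < hatAbs abv F G ∧
      Tendsto (fun i : ℕ => (F.comp^[i] G).coeffAbs abv ^ (1 / (F.deg : ℝ) ^ i))
        atTop (𝓝 (hatAbs abv F G))) :
    Tendsto (fun i => Real.log ((F.comp^[i] G).coeffAbs abv) / (F.deg : ℝ) ^ i) atTop
      (𝓝 (Real.log (hatAbs abv F G))) := by
  refine ((Real.continuousAt_log h.1.ne').tendsto.comp h.2).congr fun i => ?_
  rw [Function.comp_apply, Real.log_rpow (hpos i), one_div_mul_eq_div]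

/-! ### Nonarchimedean places: integrals over the polydisc -/

section FinitePlaces

variable {K : Type*} [Field K] [NumberField K] (v : HeightOneSpectrum (𝓞 K)) {m M : ℕ}

theorem localDegree_ne_zero : localDegree v ≠ 0 :=
  Nat.mul_ne_zero (Ideal.ramificationIdx_pos ..).ne' (Ideal.inertiaDeg_pos ..).ne'

theorem absFin_zero : absFin v 0 = 0 := by
  have : (localDegree v : ℝ) ≠ 0 := Nat.cast_ne_zero.mpr (localDegree_ne_zero v)
  rw [absFin, norm_zero, Real.zero_rpow (one_div_ne_zero this)]

theorem absFin_one : absFin v 1 = 1 := by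
  rw [absFin, norm_one, Real.one_rpow]

theorem eq_zero_of_absFin_eq_zero (x : v.adicCompletion K) (hx : absFin v x = 0) : x = 0 :=
  norm_eq_zero.mp ((Real.rpow_eq_zero_iff_of_nonneg (norm_nonneg x)).mp hx).1

theorem absFin_pow_localDegree (x : v.adicCompletion K) : absFin v x ^ localDegree v = ‖x‖ := by
  rw [absFin, one_div, Real.rpow_inv_natCast_pow (norm_nonneg x) (localDegree_ne_zero v)]

theorem isNonarchimedean_absFin : IsNonarchimedean (absFin v) := fun x y => by
  have hmono : ∀ a b : ℝ, 0 ≤ a → a ≤ b → a ^ (1 / (localDegree v : ℝ)) ≤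
      b ^ (1 / (localDegree v : ℝ)) := fun a b ha hab =>
    Real.rpow_le_rpow ha hab (by positivity)
  rcases le_max_iff.mp (IsUltrametricDist.norm_add_le_max x y) with h | h
  · exact le_max_of_le_left (hmono _ _ (norm_nonneg _) h)
  · exact le_max_of_le_right (hmono _ _ (norm_nonneg _) h)

/-- The restriction of `absFin v` to `K`. -/
noncomputable def absFinAbv : AbsoluteValue K ℝ where
  toFun c := absFin v (algebraMap K (v.adicCompletion K) c)
  map_mul' x y := by rw [map_mul, absFin_mul]
  nonneg' x := absFin_nonneg v _
  eq_zero' x := ⟨fun h => (map_eq_zero _).mp (eq_zero_of_absFin_eq_zero v _ h), fun h => by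
    rw [h, map_zero, absFin_zero]⟩
  add_le' x y := by
    rw [map_add]
    exact (isNonarchimedean_absFin v _ _).trans
      (max_le_add_of_nonneg (absFin_nonneg v _) (absFin_nonneg v _))

theorem absFinAbv_apply (c : K) : absFin v (algebraMap K (v.adicCompletion K) c) = absFinAbv v c :=
  rfl

theorem isNonarchimedean_absFinAbv : IsNonarchimedean (absFinAbv v) := fun x y => by
  rw [← absFinAbv_apply, map_add]
  exact isNonarchimedean_absFin v _ _

theorem isPowNorm_absFin : IsPowNorm (absFinAbv v) (absFin v) where
  nonneg := absFin_nonneg v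
  map_zero := absFin_zero v
  add_le x y := (isNonarchimedean_absFin v _ _).trans
      (max_le_add_of_nonneg (absFin_nonneg v _) (absFin_nonneg v _))
  mul_le x y := (absFin_mul v x y).le
  map_pow x n := by
    induction n with
    | zero => rw [pow_zero, pow_zero, absFin_one]
    | succ n ih => rw [pow_succ, pow_succ, absFin_mul, ih]
  map_algebraMap c := rfl

theorem tendsto_hatAbs_fin (F : ProjLift K M M) (hd : 2 ≤ F.deg) (G : ProjLift K m M) :
    0 < hatAbs (absFin v) F G ∧
      Tendsto (fun i : ℕ => (F.comp^[i] G).coeffAbs (absFin v) ^ (1 / (F.deg : ℝ) ^ i))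
        atTop (𝓝 (hatAbs (absFin v) F G)) :=
  tendsto_hatAbs (absFinAbv v) (absFinAbv_apply v)
    (isPowNorm_gaussNorm _ (isNonarchimedean_absFinAbv v)) (fun _ => le_rfl)
    (fun P D _ => le_mul_of_one_le_left (gaussNorm_nonneg _ P)
      (one_le_pow₀ (by exact_mod_cast Nat.succ_le_succ (Nat.zero_le D)))) F hd G

theorem coeffAbs_absFin_pos (F : ProjLift K m M) : 0 < F.coeffAbs (absFin v) :=
  coeffAbs_pos (absFinAbv v) (absFinAbv_apply v) F

theorem measurable_tupleAbs_absFin : Measurable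
    (tupleAbs (absFin v) : (Fin (m + 1) → v.adicCompletion K) → ℝ) := by
  have hc : Continuous (absFin v) :=
    continuous_norm.rpow_const fun _ => Or.inr (by positivity)
  exact Measurable.iSup fun j => hc.measurable.comp (measurable_pi_apply j)

theorem measurable_tupleAbs_eval_fin (F : ProjLift K m M) : Measurable
    fun z : Fin (m + 1) → v.adicCompletion K => tupleAbs (absFin v) (F.eval z) :=
  (measurable_tupleAbs_absFin v).comp (continuous_projLift_eval F).measurable

theorem measurable_green_eval_fin (F : ProjLift K M M) (hd : 2 ≤ F.deg) (G : ProjLift K m M)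
    (he : 1 ≤ G.deg) : Measurable
    fun z : Fin (m + 1) → v.adicCompletion K => green (absFin v) F (G.eval z) := by
  have hν := isPowNorm_absFin v
  obtain ⟨B, hB⟩ := hν.exists_green_bound (eq_zero_of_absFin_eq_zero v) F hd
  refine measurable_of_tendsto_metrizable (f := fun (i : ℕ) z =>
    Real.log (tupleAbs (absFin v) ((F.comp^[i] G).eval z)) / (F.deg : ℝ) ^ i)
    (fun i => (Real.measurable_log.comp (measurable_tupleAbs_eval_fin v _)).div_const _)
    (tendsto_pi_nhds.mpr fun z => ?_)
  -- Convergence is needed at every point; at the origin both sides are zero because `Real.log 0 =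
  -- 0`.
  by_cases hz : z = 0
  · subst hz
    have h0 : ∀ i, (F.comp^[i] G).eval (0 : Fin (m + 1) → v.adicCompletion K) = 0 := fun i => by
      refine ProjLift.eval_zero _ ?_
      rw [ProjLift.iterate_comp_deg]
      exact Nat.mul_pos (pow_pos (by omega) _) he
    rw [G.eval_zero he, green_zero (by omega) (absFin_zero v)]
    simp only [h0]
    simp [tupleAbs, absFin_zero]
  · simp only [ProjLift.iterate_comp_eval]
    exact (hB _ (hν.eval_ne_zero (eq_zero_of_absFin_eq_zero v) G he hz)).1

theorem tupleAbs_absFin_zero : tupleAbs (absFin v) (0 : Fin (m + 1) → v.adicCompletion K) = 0 := by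
  simp [tupleAbs, absFin_zero]

/-- The integrand of `integralFin` for the composed lift `F^i ∘ G`. -/
theorem integrandFin_eq {F : ProjLift K M M} (hd : 2 ≤ F.deg) {G : ProjLift K m M}
    (he : 1 ≤ G.deg) (i : ℕ) (z : Fin (m + 1) → v.adicCompletion K) :
    (tupleAbs (absFin v) z * (F.comp^[i] G).coeffAbs (absFin v) ^ (1 / ((F.comp^[i] G).deg : ℝ)) /
      tupleAbs (absFin v) ((F.comp^[i] G).eval z) ^ (1 / ((F.comp^[i] G).deg : ℝ))) ^
        (localDegree v * (m + 1)) =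
    (tupleAbs (absFin v) z *
      Real.exp (Real.log ((F.comp^[i] G).coeffAbs (absFin v)) / (F.deg : ℝ) ^ i / G.deg) /
      Real.exp (Real.log (tupleAbs (absFin v) ((F.comp^[i] G).eval z)) / (F.deg : ℝ) ^ i / G.deg)) ^
        (localDegree v * (m + 1)) := by
  by_cases hz : z = 0
  · simp [hz, tupleAbs_absFin_zero]
  · have hν := isPowNorm_absFin v
    have hdeg : 1 ≤ (F.comp^[i] G).deg := by
      rw [ProjLift.iterate_comp_deg]
      exact Nat.mul_pos (pow_pos (by omega) _) he
    have hpos := hν.tupleAbs_pos (eq_zero_of_absFin_eq_zero v)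
      (hν.eval_ne_zero (eq_zero_of_absFin_eq_zero v) (F.comp^[i] G) hdeg hz)
    rw [ProjLift.iterate_comp_deg, rpow_one_div_pow_mul (coeffAbs_absFin_pos v _),
      rpow_one_div_pow_mul hpos]

theorem hatIntegrand_eq_mul {F : ProjLift K M M} (G : ProjLift K m M)
    (z : Fin (m + 1) → v.adicCompletion K) :
    hatIntegrand v F G z =
      (hatAbs (absFin v) F G ^ (1 / (G.deg : ℝ))) ^ (localDegree v * (m + 1)) *
        greenIntegrand v F G z := by
  rw [hatIntegrand, greenIntegrand, ← mul_pow]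
  congr 1
  ring

theorem measurable_greenIntegrand (F : ProjLift K M M) (hd : 2 ≤ F.deg) (G : ProjLift K m M)
    (he : 1 ≤ G.deg) : Measurable (greenIntegrand v F G) :=
  ((measurable_tupleAbs_absFin v).div (Real.measurable_exp.comp
    ((measurable_green_eval_fin v F hd G he).div_const _))).pow_const _

instance : IsFiniteMeasure ((muFin v m).restrict (polydisc v m : Set _)) :=
  ⟨by
    rw [Measure.restrict_apply_univ, muFin, Measure.addHaarMeasure_self]
    exact ENNReal.one_lt_top⟩

/-- If `𝓖 ∘ G ≥ e log |z| - B`, then `|z| A / exp (u / e)` is bounded by `A exp (B / e)`. -/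
theorem mul_exp_div_exp_le {r a u B : ℝ} (hr : 0 < r) {e : ℕ} (he : 1 ≤ e)
    (h : e * Real.log r - B ≤ u) :
    r * Real.exp (a / e) / Real.exp (u / e) ≤ Real.exp (a / e + B / e) := by
  have he' : (0 : ℝ) < e := by exact_mod_cast he
  rw [div_le_iff₀ (Real.exp_pos _), ← Real.exp_add]
  conv_lhs => rw [← Real.exp_log hr]
  rw [← Real.exp_add, Real.exp_le_exp, ← sub_nonneg]
  have : a / e + B / e + u / e - (Real.log r + a / e) = (u - (e * Real.log r - B)) / e := by
    field_simp
    ring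
  rw [this]
  exact div_nonneg (by linarith) he'.le

/-- The measure on the polydisc is finite, and the integrand is bounded because `𝓖 (G z)` differs
from `e log |z|` by a bounded amount. -/
theorem integrableOn_greenIntegrand (F : ProjLift K M M) (hd : 2 ≤ F.deg) (G : ProjLift K m M)
    (he : 1 ≤ G.deg) : IntegrableOn (greenIntegrand v F G) (polydisc v m) (muFin v m) := by
  have hν := isPowNorm_absFin v
  obtain ⟨B, hB⟩ := hν.exists_green_eval_bound (eq_zero_of_absFin_eq_zero v) F hd G he
  refine Integrable.of_bound (measurable_greenIntegrand v F hd G he).aestronglyMeasurable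
    (Real.exp (B / G.deg) ^ (localDegree v * (m + 1))) (ae_of_all _ fun z => ?_)
  rw [greenIntegrand, norm_pow]
  refine pow_le_pow_left₀ (norm_nonneg _) ?_ _
  by_cases hz : z = 0
  · rw [hz, tupleAbs_absFin_zero, zero_div, norm_zero]
    positivity
  · have hp := hν.tupleAbs_pos (eq_zero_of_absFin_eq_zero v) hz
    rw [Real.norm_of_nonneg (by positivity)]
    have := mul_exp_div_exp_le (a := 0) hp he
      (show G.deg * Real.log (tupleAbs (absFin v) z) - B ≤ green (absFin v) F (G.eval z) by
        linarith [(abs_le.mp (hB z hz)).1])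
    simpa using this

theorem integrableOn_hatIntegrand (F : ProjLift K M M) (hd : 2 ≤ F.deg) (G : ProjLift K m M)
    (he : 1 ≤ G.deg) : IntegrableOn (hatIntegrand v F G) (polydisc v m) (muFin v m) := by
  rw [show hatIntegrand v F G = _ from funext (hatIntegrand_eq_mul v G)]
  exact (integrableOn_greenIntegrand v F hd G he).const_mul _

theorem tendsto_integralFin (F : ProjLift K M M) (hd : 2 ≤ F.deg) (G : ProjLift K m M)
    (he : 1 ≤ G.deg) :
    Tendsto (fun i : ℕ => integralFin v (F.comp^[i] G)) atTop
      (𝓝 (∫ z in (polydisc v m : Set (Fin (m + 1) → v.adicCompletion K)),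
          hatIntegrand v F G z ∂(muFin v m))) := by
  have hν := isPowNorm_absFin v
  have hhat := tendsto_hatAbs_fin v F hd G
  have hlog := tendsto_log_coeffAbs (fun i => coeffAbs_absFin_pos v _) hhat
  obtain ⟨A, hA⟩ := hlog.bddAbove_range
  obtain ⟨B, hB⟩ := hν.exists_green_eval_bound (eq_zero_of_absFin_eq_zero v) F hd G he
  obtain ⟨B', hB'⟩ := hν.exists_green_comp_bound (eq_zero_of_absFin_eq_zero v) F hd G he
  have hd1 : (1 : ℝ) < F.deg := by exact_mod_cast hd
  have he0 : (0 : ℝ) < G.deg := by exact_mod_cast he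
  simp only [integralFin, integrandFin_eq v hd he]
  refine tendsto_integral_of_dominated_convergence
    -- A constant majorant: `A` bounds `log |F^i ∘ G| / d^i`, `B` bounds `𝓖 ∘ G - e log |z|`, and
    -- `|B'|` bounds the error of the `i`-th approximation of `𝓖 ∘ G`, as `d^{-i} ≤ 1`.
    (fun _ => Real.exp (A / G.deg + (B + |B'|) / G.deg) ^ (localDegree v * (m + 1)))
    (fun i => ?_) (integrable_const _) (fun i => ae_of_all _ fun z => ?_)
    (ae_of_all _ fun z => ?_)
  · exact ((((measurable_tupleAbs_absFin v).mul_const _).div (Real.measurable_exp.comp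
      (((Real.measurable_log.comp (measurable_tupleAbs_eval_fin v _)).div_const _).div_const
        _))).pow_const _).aestronglyMeasurable
  · rw [norm_pow]
    refine pow_le_pow_left₀ (norm_nonneg _) ?_ _
    by_cases hz : z = 0
    · rw [hz, tupleAbs_absFin_zero, zero_mul, zero_div, norm_zero]
      positivity
    · have hp := hν.tupleAbs_pos (eq_zero_of_absFin_eq_zero v) hz
      rw [Real.norm_of_nonneg (by positivity)]
      refine (mul_exp_div_exp_le (B := B + |B'|) hp he ?_).trans (Real.exp_le_exp.mpr ?_)
      · have h1 := (abs_le.mp (hB z hz)).1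
        have h2 := (abs_le.mp (hB' z hz i)).1
        have h3 : B' * (1 / (F.deg : ℝ)) ^ i ≤ |B'| := by
          refine (mul_le_mul_of_nonneg_right (le_abs_self B') (by positivity)).trans ?_
          refine mul_le_of_le_one_right (abs_nonneg _) (pow_le_one₀ (by positivity) ?_)
          rw [div_le_one (by linarith)]
          exact hd1.le
        linarith
      · have := hA ⟨i, rfl⟩
        gcongr
  · by_cases hz : z = 0
    · have hk : localDegree v * (m + 1) ≠ 0 := Nat.mul_ne_zero (localDegree_ne_zero v) (by omega)
      simp [hz, tupleAbs_absFin_zero, hatIntegrand, zero_pow hk]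
    · have hgreen : Tendsto (fun i : ℕ => Real.log (tupleAbs (absFin v)
          ((F.comp^[i] G).eval z)) / (F.deg : ℝ) ^ i) atTop
          (𝓝 (green (absFin v) F (G.eval z))) := by
        obtain ⟨C, hC⟩ := hν.exists_green_bound (eq_zero_of_absFin_eq_zero v) F hd
        simp only [ProjLift.iterate_comp_eval]
        exact (hC _ (hν.eval_ne_zero (eq_zero_of_absFin_eq_zero v) G he hz)).1
      have hA' : hatAbs (absFin v) F G ^ (1 / (G.deg : ℝ)) =
          Real.exp (Real.log (hatAbs (absFin v) F G) / G.deg) := by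
        rw [Real.rpow_def_of_pos hhat.1, mul_one_div]
      rw [hatIntegrand, hA']
      refine ((((Real.continuous_exp.tendsto _).comp (hlog.div_const _)).const_mul _).div
        ((Real.continuous_exp.tendsto _).comp (hgreen.div_const _)) (Real.exp_ne_zero _)).pow _

theorem exists_ne_zero_norm_ne_one : ∃ x : v.adicCompletion K, x ≠ 0 ∧ ‖x‖ ≠ 1 := by
  obtain ⟨π, hπ, h⟩ := Submodule.exists_mem_ne_zero_of_ne_bot v.ne_bot
  exact ⟨algebraMap K _ (algebraMap (𝓞 K) K π), by simpa using h,
    ((FinitePlace.norm_lt_one_iff_mem K v π).mpr hπ).ne⟩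

/-- An element of norm different from 0 and 1 makes the origin non-isolated, and then Haar measure
has no atoms. -/
theorem muFin_singleton_zero : muFin v m {0} = 0 := by
  let : NontriviallyNormedField (v.adicCompletion K) :=
    NontriviallyNormedField.ofNormNeOne (exists_ne_zero_norm_ne_one v)
  have : NeBot (𝓝[≠] (0 : Fin (m + 1) → v.adicCompletion K)) :=
    Module.punctured_nhds_neBot (v.adicCompletion K) _ 0
  have : (muFin v m).IsAddHaarMeasure :=
    inferInstanceAs (Measure.addHaarMeasure (polydisc v m)).IsAddHaarMeasure
  exact measure_singleton 0

/-- The origin must be excepted: there the integrands vanish even under good reduction. -/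
theorem setIntegral_eq_one_of_eq_one {φ : (Fin (m + 1) → v.adicCompletion K) → ℝ}
    (h : ∀ z, z ≠ 0 → φ z = 1) :
    ∫ z in (polydisc v m : Set (Fin (m + 1) → v.adicCompletion K)), φ z ∂(muFin v m) = 1 := by
  have hae : φ =ᵐ[(muFin v m).restrict (polydisc v m : Set _)] fun _ => (1 : ℝ) := by
    refine ae_restrict_of_ae ?_
    have : ∀ᵐ z ∂(muFin v m), z ∉ ({0} : Set (Fin (m + 1) → v.adicCompletion K)) :=
      measure_eq_zero_iff_ae_notMem.mp (muFin_singleton_zero v)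
    filter_upwards [this] with z hz
    exact h z (by simpa using hz)
  rw [integral_congr_ae hae, integral_const, measureReal_restrict_apply_univ, measureReal_def,
    muFin, Measure.addHaarMeasure_self]
  simp

theorem integral_greenIntegrand_eq_one {F : ProjLift K M M}
    (hF : F.HasGoodReduction (absFinAbv v)) (hd : 2 ≤ F.deg)
    {G : ProjLift K m M} (hG : G.HasGoodReduction (absFinAbv v)) (he : 1 ≤ G.deg) :
    ∫ z in (polydisc v m : Set (Fin (m + 1) → v.adicCompletion K)),
      greenIntegrand v F G z ∂(muFin v m) = 1 := by
  refine setIntegral_eq_one_of_eq_one v fun z hz => ?_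
  have hν := isPowNorm_absFin v
  have hp := hν.tupleAbs_pos (eq_zero_of_absFin_eq_zero v) hz
  have he0 : (G.deg : ℝ) ≠ 0 := by positivity
  rw [greenIntegrand, green_of_hasGoodReduction hν (isNonarchimedean_absFin v) hF hd hG he,
    mul_div_cancel_left₀ _ he0, Real.exp_log hp, div_self hp.ne', one_pow]

theorem integralFin_eq_one {F : ProjLift K M M}
    (hF : F.HasGoodReduction (absFinAbv v)) (hd : 2 ≤ F.deg)
    {G : ProjLift K m M} (hG : G.HasGoodReduction (absFinAbv v)) (he : 1 ≤ G.deg) (i : ℕ) :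
    integralFin v (F.comp^[i] G) = 1 := by
  refine setIntegral_eq_one_of_eq_one v fun z hz => ?_
  have hν := isPowNorm_absFin v
  have hp := hν.tupleAbs_pos (eq_zero_of_absFin_eq_zero v) hz
  have hdeg : (F.comp^[i] G).deg ≠ 0 := by
    rw [ProjLift.iterate_comp_deg]
    exact (Nat.mul_pos (pow_pos (by omega) _) he).ne'
  rw [tupleAbs_iterate_comp_eval hν (isNonarchimedean_absFin v) hF (by omega) hG he,
    coeffAbs_eq_one_of_hasGoodReduction (absFinAbv_apply v) (isNonarchimedean_absFinAbv v) hF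
      (by omega) hG he, Real.one_rpow, mul_one, one_div, Real.pow_rpow_inv_natCast hp.le hdeg,
    div_self hp.ne', one_pow]

variable (K) in
theorem eventually_absFinAbv_le_one (c : K) :
    ∀ᶠ v : HeightOneSpectrum (𝓞 K) in cofinite, absFinAbv v c ≤ 1 := by
  by_cases hc : c = 0
  · exact Eventually.of_forall fun v => by simp [hc]
  have hfin : {w : FinitePlace K | w c ≠ 1}.Finite := FinitePlace.hasFiniteMulSupport hc
  have hfin' : {v : HeightOneSpectrum (𝓞 K) | FinitePlace.mk v c ≠ 1}.Finite :=
    hfin.preimage (f := FinitePlace.mk) (fun v₁ _ v₂ _ h => FinitePlace.mk_eq_iff.mp h)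
  refine Filter.eventually_cofinite.mpr (hfin'.subset fun v hv => fun h1 => hv ?_)
  have h2 : ‖algebraMap K (v.adicCompletion K) c‖ = 1 := h1
  change absFin v _ ≤ 1
  rw [absFin, h2, Real.one_rpow]

/-- A single Nullstellensatz certificate over `K` serves all primes; its finitely many coefficients
and those of `F` are integral at almost all of them. -/
theorem eventually_hasGoodReduction (F : ProjLift K m M) :
    ∀ᶠ v : HeightOneSpectrum (𝓞 K) in cofinite, F.HasGoodReduction (absFinAbv v) := by
  have hcoeff : ∀ P : MvPolynomial (Fin (m + 1)) K,
      ∀ᶠ v : HeightOneSpectrum (𝓞 K) in cofinite, ∀ s, absFinAbv v (P.coeff s) ≤ 1 := fun P => by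
    have : ∀ᶠ v : HeightOneSpectrum (𝓞 K) in cofinite,
        ∀ s ∈ P.support, absFinAbv v (P.coeff s) ≤ 1 :=
      (Filter.eventually_all_finset _).mpr fun s _ => eventually_absFinAbv_le_one K _
    filter_upwards [this] with v hv s
    by_cases hs : s ∈ P.support
    · exact hv s hs
    · rw [MvPolynomial.notMem_support_iff.mp hs, map_zero]
      exact zero_le_one
  obtain ⟨N, h, hh, hX⟩ := F.exists_X_pow_eq_sum
  have h1 : ∀ᶠ v : HeightOneSpectrum (𝓞 K) in cofinite, ∀ j k s,
      absFinAbv v ((h j k).coeff s) ≤ 1 :=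
    Filter.eventually_all.mpr fun j => Filter.eventually_all.mpr fun k => hcoeff _
  have h2 : ∀ᶠ v : HeightOneSpectrum (𝓞 K) in cofinite, ∀ k s,
      absFinAbv v ((F.form k).coeff s) ≤ 1 :=
    Filter.eventually_all.mpr fun k => hcoeff _
  filter_upwards [h1, h2] with v hv1 hv2
  exact ⟨N, h, hh, hX, hv1, hv2⟩

end FinitePlaces

/-! ### Archimedean places: volumes of sublevel sets -/

section InfinitePlaces

variable {K : Type*} [Field K] (v : InfinitePlace K) {m M : ℕ}

theorem absInf_algebraMap (c : K) : absInf v (algebraMap K v.Completion c) = v.1 c :=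
  InfinitePlace.Completion.norm_coe v _

theorem isPowNorm_absInf : IsPowNorm v.1 (absInf v) where
  nonneg := norm_nonneg
  map_zero := norm_zero
  add_le := norm_add_le
  mul_le x y := (norm_mul x y).le
  map_pow := norm_pow
  map_algebraMap := absInf_algebraMap v

theorem eq_zero_of_absInf_eq_zero (x : v.Completion) (hx : absInf v x = 0) : x = 0 :=
  norm_eq_zero.mp hx

theorem coeffAbs_absInf_pos (F : ProjLift K m M) : 0 < F.coeffAbs (absInf v) :=
  coeffAbs_pos v.1 (absInf_algebraMap v) F

theorem tendsto_hatAbs_inf (F : ProjLift K M M) (hd : 2 ≤ F.deg) (G : ProjLift K m M) :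
    0 < hatAbs (absInf v) F G ∧
      Tendsto (fun i : ℕ => (F.comp^[i] G).coeffAbs (absInf v) ^ (1 / (F.deg : ℝ) ^ i))
        atTop (𝓝 (hatAbs (absInf v) F G)) := by
  have hnorm : ∀ c, ‖v.embedding c‖ = v.1 c := fun c => InfinitePlace.norm_embedding_eq v c
  have hν : IsPowNorm (R := MvPolynomial (Fin (m + 1)) K) v.1 (torusNorm v.embedding) := by
    have := isPowNorm_torusNorm (σ := Fin (m + 1)) v.embedding
    simpa only [hnorm] using! this
  refine tendsto_hatAbs v.1 (absInf_algebraMap v) hν (fun P => gaussNorm_le _ fun s => ?_)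
    (fun P D hP => ?_) F hd G
  · rw [← hnorm]
    exact norm_coeff_le_torusNorm v.embedding P s
  · calc torusNorm v.embedding P ≤ ∑ s ∈ P.support, ‖v.embedding (P.coeff s)‖ := torusNorm_le _ P
      _ ≤ ∑ s ∈ P.support, gaussNorm v.1 P := Finset.sum_le_sum fun s _ => by
          rw [hnorm]
          exact abv_coeff_le_gaussNorm v.1 P s
      _ = P.support.card * gaussNorm v.1 P := by rw [Finset.sum_const, nsmul_eq_mul]
      _ ≤ _ := mul_le_mul_of_nonneg_right (by exact_mod_cast card_support_le hP)
          (gaussNorm_nonneg _ P)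

/-! ### Carrying Lebesgue measure over to `ℝ` or `ℂ` -/

section Transport

variable {E : Type*} [NormedField E] [NormedAlgebra ℝ E] [FiniteDimensional ℝ E] [MeasureSpace E]
  [BorelSpace E] [(volume : Measure E).IsAddHaarMeasure]

theorem measurePreserving_transport (φ : v.Completion ≃ᵢ E)
    (hμ : lebesgueInf v = (volume : Measure E).map φ.symm) :
    MeasurePreserving (MeasurableEquiv.piCongrRight fun _ : Fin (m + 1) =>
      φ.toHomeomorph.toMeasurableEquiv) (muInf v m)
      (volume : Measure (Fin (m + 1) → E)) := by
  have : ProperSpace E := FiniteDimensional.proper ℝ E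
  have h1 : MeasurePreserving φ.toHomeomorph.toMeasurableEquiv.symm (volume : Measure E)
      (lebesgueInf v) := ⟨MeasurableEquiv.measurable _, hμ.symm⟩
  exact measurePreserving_pi _ _ fun _ => h1.symm

theorem muInf_eq_volume_image (φ : v.Completion ≃ᵢ E)
    (hμ : lebesgueInf v = (volume : Measure E).map φ.symm) (S : Set (Fin (m + 1) → v.Completion)) :
    muInf v m S = volume ((fun z (i : Fin (m + 1)) => φ (z i)) '' S) := by
  rw [← (measurePreserving_transport v φ hμ).measure_preimage_equiv]
  congr 1
  exact (Set.preimage_image_eq S (MeasurableEquiv.injective _)).symm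

-- The scalar `c` corresponds to the real number `t` in `E`. As `φ` is multiplicative,
-- multiplication by `c` becomes the real homothety of ratio `t` on a space of dimension `finrank ℝ
-- E * (m + 1)`.
open scoped Pointwise in
theorem muInf_smul_of_isometryEquiv (φ : v.Completion ≃ᵢ E)
    (hmul : ∀ x y, φ (x * y) = φ x * φ y) (h0 : φ 0 = 0)
    (hμ : lebesgueInf v = (volume : Measure E).map φ.symm) {t : ℝ} (ht : 0 < t) :
    ∃ c : v.Completion, ‖c‖ = t ∧ ∀ S : Set (Fin (m + 1) → v.Completion),
      muInf v m ((fun z => c • z) '' S) =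
        ENNReal.ofReal (t ^ (Module.finrank ℝ E * (m + 1))) * muInf v m S := by
  have : ProperSpace E := FiniteDimensional.proper ℝ E
  have hc : φ (φ.symm (algebraMap ℝ E t)) = algebraMap ℝ E t := φ.apply_symm_apply _
  refine ⟨φ.symm (algebraMap ℝ E t), ?_, fun S => ?_⟩
  · have := φ.isometry.norm_map_of_map_zero h0 (φ.symm (algebraMap ℝ E t))
    rw [← this, hc, norm_algebraMap', Real.norm_of_nonneg ht.le]
  · rw [muInf_eq_volume_image v φ hμ, muInf_eq_volume_image v φ hμ]
    have himg : (fun z (i : Fin (m + 1)) => φ (z i)) ''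
        ((fun z => φ.symm (algebraMap ℝ E t) • z) '' S) =
        t • ((fun z (i : Fin (m + 1)) => φ (z i)) '' S) := by
      rw [← Set.image_smul, Set.image_image, Set.image_image]
      refine Set.image_congr fun z _ => ?_
      funext i
      simp only [Pi.smul_apply, smul_eq_mul, hmul, hc, Algebra.smul_def]
    rw [himg, Measure.addHaar_smul, Module.finrank_pi_fintype]
    simp only [Finset.sum_const, Finset.card_univ, Fintype.card_fin, smul_eq_mul]
    rw [abs_of_pos (pow_pos ht _), mul_comm (m + 1)]

theorem muInf_lt_top_of_isometryEquiv (φ : v.Completion ≃ᵢ E) (h0 : φ 0 = 0)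
    (hμ : lebesgueInf v = (volume : Measure E).map φ.symm)
    {S : Set (Fin (m + 1) → v.Completion)} {r : ℝ} (hS : ∀ z ∈ S, ∀ i, ‖z i‖ ≤ r) :
    muInf v m S < ⊤ := by
  have : ProperSpace E := FiniteDimensional.proper ℝ E
  rw [muInf_eq_volume_image v φ hμ]
  refine (measure_mono ?_).trans_lt (isCompact_closedBall (0 : Fin (m + 1) → E) |r|).measure_lt_top
  rintro _ ⟨z, hz, rfl⟩
  rw [mem_closedBall_zero_iff, pi_norm_le_iff_of_nonneg (abs_nonneg r)]
  intro i
  rw [φ.isometry.norm_map_of_map_zero h0]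
  exact (hS z hz i).trans (le_abs_self r)

end Transport

theorem exists_muInf_smul (m : ℕ) {t : ℝ} (ht : 0 < t) :
    ∃ c : v.Completion, ‖c‖ = t ∧ ∀ S : Set (Fin (m + 1) → v.Completion),
      muInf v m ((fun z => c • z) '' S) =
        ENNReal.ofReal (t ^ (v.mult * (m + 1))) * muInf v m S := by
  by_cases hv : v.IsReal
  · have hm : v.mult = Module.finrank ℝ ℝ := by
      rw [InfinitePlace.mult_isReal ⟨v, hv⟩, Module.finrank_self]
    rw [hm]
    exact muInf_smul_of_isometryEquiv v (InfinitePlace.Completion.isometryEquivRealOfIsReal hv)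
      (map_mul (InfinitePlace.Completion.ringEquivRealOfIsReal hv))
      (map_zero (InfinitePlace.Completion.ringEquivRealOfIsReal hv))
      (by rw [lebesgueInf, dif_pos hv]) ht
  · have hv' := InfinitePlace.not_isReal_iff_isComplex.mp hv
    have hm : v.mult = Module.finrank ℝ ℂ := by
      rw [InfinitePlace.mult_isComplex ⟨v, hv'⟩, Complex.finrank_real_complex]
    rw [hm]
    exact muInf_smul_of_isometryEquiv v
      (InfinitePlace.Completion.isometryEquivComplexOfIsComplex hv')
      (map_mul (InfinitePlace.Completion.ringEquivComplexOfIsComplex hv'))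
      (map_zero (InfinitePlace.Completion.ringEquivComplexOfIsComplex hv'))
      (by rw [lebesgueInf, dif_neg hv]) ht

theorem muInf_lt_top_of_bounded {S : Set (Fin (m + 1) → v.Completion)} {r : ℝ}
    (hS : ∀ z ∈ S, ∀ i, ‖z i‖ ≤ r) : muInf v m S < ⊤ := by
  by_cases hv : v.IsReal
  · exact muInf_lt_top_of_isometryEquiv v (InfinitePlace.Completion.isometryEquivRealOfIsReal hv)
      (map_zero (InfinitePlace.Completion.ringEquivRealOfIsReal hv))
      (by rw [lebesgueInf, dif_pos hv]) hS
  · have hv' := InfinitePlace.not_isReal_iff_isComplex.mp hv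
    exact muInf_lt_top_of_isometryEquiv v
      (InfinitePlace.Completion.isometryEquivComplexOfIsComplex hv')
      (map_zero (InfinitePlace.Completion.ringEquivComplexOfIsComplex hv'))
      (by rw [lebesgueInf, dif_neg hv]) hS

theorem muInf_singleton_zero : muInf v m {0} = 0 := by
  obtain ⟨c, -, h⟩ := exists_muInf_smul v m (t := 2) two_pos
  have h1 := h {0}
  rw [Set.image_singleton, smul_zero] at h1
  have hfin : muInf v m {0} < ⊤ := muInf_lt_top_of_bounded v (r := 0) (by simp)
  by_contra hne
  -- Scaling by an element of norm 2 fixes `{0}`; if its finite measure were nonzero, the scaling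
  -- factor would have to be one.
  have h2 : ENNReal.ofReal ((2 : ℝ) ^ (v.mult * (m + 1))) = 1 := by
    conv_lhs at h1 => rw [← one_mul (muInf v m {0})]
    exact ((ENNReal.mul_left_inj hne hfin.ne).mp h1).symm
  rw [ENNReal.ofReal_eq_one] at h2
  have h3 : (1 : ℝ) < 2 ^ (v.mult * (m + 1)) :=
    one_lt_pow₀ one_lt_two (Nat.mul_pos InfinitePlace.mult_pos (by omega)).ne'
  exact h3.ne' h2

/-- The sublevel sets of `𝓖_{F,v} ∘ G`, including the origin. -/
def greenSublevel (F : ProjLift K M M) (G : ProjLift K m M) (t : ℝ) :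
    Set (Fin (m + 1) → v.Completion) :=
  {z | z = 0 ∨ green (absInf v) F (G.eval z) ≤ t}

theorem greenDomain_eq_greenSublevel {F : ProjLift K M M} (hd : 2 ≤ F.deg) {G : ProjLift K m M}
    (he : 1 ≤ G.deg) : greenDomain v F G = greenSublevel v F G 0 := by
  ext z
  refine ⟨Or.inr, ?_⟩
  rintro (rfl | h)
  · change green (absInf v) F (G.eval 0) ≤ 0
    rw [G.eval_zero he, green_zero (by omega) norm_zero]
  · exact h

theorem green_eval_smul {F : ProjLift K M M} (hd : 2 ≤ F.deg) {G : ProjLift K m M}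
    (he : 1 ≤ G.deg) {c : v.Completion} (hc : c ≠ 0) {z : Fin (m + 1) → v.Completion} (hz : z ≠ 0) :
    green (absInf v) F (G.eval (c • z)) = G.deg * Real.log ‖c‖ + green (absInf v) F (G.eval z) := by
  have hν := isPowNorm_absInf v
  rw [G.eval_smul, hν.green_smul norm_mul (eq_zero_of_absInf_eq_zero v) F hd (pow_ne_zero _ hc)
    (hν.eval_ne_zero (eq_zero_of_absInf_eq_zero v) G he hz), hν.map_pow, Real.log_pow]
  rfl

/-- Since `𝓖 (G (c z)) = e log |c| + 𝓖 (G z)`, a scalar of norm `exp (t / e)` maps the sublevel set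
at 0 onto that at `t`. Including the origin makes this exact, as the default value of `𝓖` there does
not follow the scaling rule. -/
theorem muInf_greenSublevel {F : ProjLift K M M} (hd : 2 ≤ F.deg) {G : ProjLift K m M}
    (he : 1 ≤ G.deg) (t : ℝ) :
    muInf v m (greenSublevel v F G t) =
      ENNReal.ofReal (Real.exp (t / G.deg) ^ (v.mult * (m + 1))) *
        muInf v m (greenDomain v F G) := by
  obtain ⟨c, hc, h⟩ := exists_muInf_smul v m (Real.exp_pos (t / G.deg))
  have he0 : (G.deg : ℝ) ≠ 0 := by positivity
  have hc0 : c ≠ 0 := norm_pos_iff.mp (hc ▸ Real.exp_pos _)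
  have hlog : G.deg * Real.log ‖c‖ = t := by
    rw [hc, Real.log_exp, mul_div_cancel₀ _ he0]
  rw [← h, greenDomain_eq_greenSublevel v hd he]
  congr 1
  have hsmul : ∀ z : Fin (m + 1) → v.Completion,
      c • z ∈ greenSublevel v F G t ↔ z ∈ greenSublevel v F G 0 := fun z => by
    by_cases hz : z = 0
    · subst hz
      exact ⟨fun _ => Or.inl rfl, fun _ => Or.inl (smul_zero c)⟩
    · simp only [greenSublevel, Set.mem_ofPred_eq, hz, smul_eq_zero, hc0, false_or,
        green_eval_smul v hd he hc0 hz, hlog, add_le_iff_nonpos_right, or_self]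
  ext z
  constructor
  · intro hz
    refine ⟨c⁻¹ • z, (hsmul _).mp ?_, smul_inv_smul₀ hc0 z⟩
    rwa [smul_inv_smul₀ hc0]
  · rintro ⟨y, hy, rfl⟩
    exact (hsmul y).mpr hy

theorem muInf_greenDomain_lt_top {F : ProjLift K M M} (hd : 2 ≤ F.deg) {G : ProjLift K m M}
    (he : 1 ≤ G.deg) : muInf v m (greenDomain v F G) < ⊤ := by
  have hν := isPowNorm_absInf v
  obtain ⟨B, hB⟩ := hν.exists_green_eval_bound (eq_zero_of_absInf_eq_zero v) F hd G he
  have he0 : (0 : ℝ) < G.deg := by exact_mod_cast he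
  refine muInf_lt_top_of_bounded v (r := Real.exp (B / G.deg)) fun z hz i => ?_
  by_cases hz0 : z = 0
  · rw [hz0, Pi.zero_apply, norm_zero]
    positivity
  · have h1 := (abs_le.mp (hB z hz0)).1
    have hz' : green (absInf v) F (G.eval z) ≤ 0 := hz
    have hp := hν.tupleAbs_pos (eq_zero_of_absInf_eq_zero v) hz0
    refine (IsPowNorm.le_iSup (ν := absInf v) z i).trans ?_
    change tupleAbs (absInf v) z ≤ _
    rw [← Real.log_le_iff_le_exp hp, le_div_iff₀ he0]
    linarith

theorem muInf_greenSublevel_lt_top {F : ProjLift K M M} (hd : 2 ≤ F.deg) {G : ProjLift K m M}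
    (he : 1 ≤ G.deg) (t : ℝ) : muInf v m (greenSublevel v F G t) < ⊤ := by
  rw [muInf_greenSublevel v hd he]
  exact ENNReal.mul_lt_top ENNReal.ofReal_lt_top (muInf_greenDomain_lt_top v hd he)

theorem muInf_real_greenSublevel {F : ProjLift K M M} (hd : 2 ≤ F.deg) {G : ProjLift K m M}
    (he : 1 ≤ G.deg) (t : ℝ) :
    (muInf v m).real (greenSublevel v F G t) =
      Real.exp (t / G.deg) ^ (v.mult * (m + 1)) * (muInf v m).real (greenDomain v F G) := by
  rw [measureReal_def, muInf_greenSublevel v hd he, ENNReal.toReal_mul,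
    ENNReal.toReal_ofReal (by positivity), measureReal_def]

/-- The two sets can differ only at the origin, which is a null set. -/
theorem muInf_hatDomain {F : ProjLift K M M} (hd : 2 ≤ F.deg) (G : ProjLift K m M) :
    muInf v m (hatDomain v F G) =
      muInf v m (greenSublevel v F G (Real.log (hatAbs (absInf v) F G))) := by
  rw [← measure_sdiff_null (muInf_singleton_zero v (m := m)) (s := hatDomain v F G),
    ← measure_sdiff_null (muInf_singleton_zero v (m := m)) (s := greenSublevel v F G _)]
  congr 1
  ext z
  simp only [hatDomain, greenSublevel, Set.mem_sdiff, Set.mem_ofPred_eq, Set.mem_singleton_iff,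
    Real.le_log_iff_exp_le (tendsto_hatAbs_inf v F hd G).1]
  tauto

theorem muInf_real_hatDomain {F : ProjLift K M M} (hd : 2 ≤ F.deg) {G : ProjLift K m M}
    (he : 1 ≤ G.deg) :
    (muInf v m).real (hatDomain v F G) =
      (hatAbs (absInf v) F G ^ (1 / (G.deg : ℝ))) ^ (v.mult * (m + 1)) *
        (muInf v m).real (greenDomain v F G) := by
  rw [measureReal_def, muInf_hatDomain v hd, ← measureReal_def, muInf_real_greenSublevel v hd he,
    Real.rpow_def_of_pos (tendsto_hatAbs_inf v F hd G).1, mul_one_div]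

/-- By the uniform rate of convergence, the `i`-th domain lies between the sublevel sets of `𝓖 ∘ G`
at the levels `log |F^i ∘ G| / d^i ± B d^{-i}`. Both levels tend to `log |F̂ ∘ G|`, and the volume
depends continuously on the level by the scaling formula. -/
theorem tendsto_muInf_domainInf {F : ProjLift K M M} (hd : 2 ≤ F.deg) {G : ProjLift K m M}
    (he : 1 ≤ G.deg) :
    Tendsto (fun i : ℕ => (muInf v m).real (domainInf v (F.comp^[i] G))) atTop
      (𝓝 ((muInf v m).real (hatDomain v F G))) := by
  have hν := isPowNorm_absInf v
  have hlog := tendsto_log_coeffAbs (fun i => coeffAbs_absInf_pos v _) (tendsto_hatAbs_inf v F hd G)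
  obtain ⟨B, hB⟩ := hν.exists_green_comp_bound (eq_zero_of_absInf_eq_zero v) F hd G he
  have hd1 : (1 : ℝ) < F.deg := by exact_mod_cast hd
  have hsmall : Tendsto (fun i : ℕ => B * (1 / (F.deg : ℝ)) ^ i) atTop (𝓝 0) := by
    have := (tendsto_pow_atTop_nhds_zero_of_lt_one (r := 1 / (F.deg : ℝ)) (by positivity)
      ((div_lt_one (by linarith)).mpr hd1)).const_mul B
    rwa [mul_zero] at this
  have hmem : ∀ i, ∀ z : Fin (m + 1) → v.Completion, z ≠ 0 →
      (z ∈ domainInf v (F.comp^[i] G) ↔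
        Real.log (tupleAbs (absInf v) ((F.comp^[i] G).eval z)) / (F.deg : ℝ) ^ i ≤
          Real.log ((F.comp^[i] G).coeffAbs (absInf v)) / (F.deg : ℝ) ^ i) := fun i z hz => by
    have hdeg : 1 ≤ (F.comp^[i] G).deg := by
      rw [ProjLift.iterate_comp_deg]
      exact Nat.mul_pos (pow_pos (by omega) _) he
    have hpos := hν.tupleAbs_pos (eq_zero_of_absInf_eq_zero v)
      (hν.eval_ne_zero (eq_zero_of_absInf_eq_zero v) (F.comp^[i] G) hdeg hz)
    rw [div_le_div_iff_of_pos_right (by positivity),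
      Real.log_le_log_iff hpos (coeffAbs_absInf_pos v _)]
    rfl
  have hvol : Tendsto (fun t => (muInf v m).real (greenSublevel v F G t))
      (𝓝 (Real.log (hatAbs (absInf v) F G))) (𝓝 ((muInf v m).real (hatDomain v F G))) := by
    rw [measureReal_def (s := hatDomain v F G), muInf_hatDomain v hd, ← measureReal_def]
    have hcont : Continuous fun t => (muInf v m).real (greenSublevel v F G t) := by
      simp only [muInf_real_greenSublevel v hd he]
      fun_prop
    exact hcont.tendsto _
  have hlow := hlog.sub hsmall
  have hup := hlog.add hsmall
  rw [sub_zero] at hlow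
  rw [add_zero] at hup
  have hsup : ∀ i, domainInf v (F.comp^[i] G) ⊆ greenSublevel v F G
      (Real.log ((F.comp^[i] G).coeffAbs (absInf v)) / (F.deg : ℝ) ^ i +
        B * (1 / (F.deg : ℝ)) ^ i) := fun i z hz => by
    by_cases hz0 : z = 0
    · exact Or.inl hz0
    · right
      have h1 := (hmem i z hz0).mp hz
      have h2 := (abs_le.mp (hB z hz0 i)).1
      linarith
  refine tendsto_of_tendsto_of_tendsto_of_le_of_le (hvol.comp hlow) (hvol.comp hup)
    (fun i => ?_) fun i => measureReal_mono (hsup i) (muInf_greenSublevel_lt_top v hd he _).ne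
  refine measureReal_mono ?_ ((measure_mono (hsup i)).trans_lt
    (muInf_greenSublevel_lt_top v hd he _)).ne
  intro z hz
  by_cases hz0 : z = 0
  · subst hz0
    change tupleAbs (absInf v) ((F.comp^[i] G).eval 0) ≤ _
    rw [ProjLift.eval_zero _ (by
      rw [ProjLift.iterate_comp_deg]
      exact Nat.mul_pos (pow_pos (by omega) _) he)]
    have : tupleAbs (absInf v) (0 : Fin (M + 1) → v.Completion) = 0 := by simp [tupleAbs, absInf]
    rw [this]
    exact (coeffAbs_absInf_pos v _).le
  · rw [hmem i z hz0]
    have h1 := hz.resolve_left hz0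
    have h2 := (abs_le.mp (hB z hz0 i)).2
    linarith

end InfinitePlaces

/-! ### Heights, and the limit of the global constant -/

section Global

variable {K : Type*} [Field K] [NumberField K] {m M : ℕ}

/-- Raising to the power `n_v` undoes the normalization of `absFin` and gives the local factor of
`Height.mulHeight`. -/
theorem coeffAbs_absFin_pow_localDegree (v : HeightOneSpectrum (𝓞 K)) (F : ProjLift K m M) :
    F.coeffAbs (absFin v) ^ localDegree v = ⨆ p, FinitePlace.mk v (F.coeffs p) := by
  have hne : Nonempty (Fin (M + 1) ×
      (Finset.finsuppAntidiag (Finset.univ : Finset (Fin (m + 1))) F.deg)) :=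
    ⟨0, ⟨Finsupp.single 0 F.deg, by simp [Finset.mem_finsuppAntidiag]⟩⟩
  rw [ProjLift.coeffAbs]
  obtain ⟨p, hp⟩ := exists_eq_ciSup_of_finite
    (f := fun p => absFin v (algebraMap K (v.adicCompletion K) (F.coeffs p)))
  have hval : ∀ q, absFin v (algebraMap K (v.adicCompletion K) (F.coeffs q)) ^ localDegree v =
      FinitePlace.mk v (F.coeffs q) := fun q => absFin_pow_localDegree v _
  refine le_antisymm ?_ (ciSup_le fun q => ?_)
  · rw [← hp, hval]
    exact le_ciSup (f := fun q => FinitePlace.mk v (F.coeffs q)) (Set.finite_range _).bddAbove p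
  · rw [← hval]
    exact pow_le_pow_left₀ (absFin_nonneg v _)
      (le_ciSup (f := fun q => absFin v (algebraMap K (v.adicCompletion K) (F.coeffs q)))
        (Set.finite_range _).bddAbove q) _

theorem coeffs_ne_zero (F : ProjLift K m M) : F.coeffs ≠ 0 := fun h => by
  obtain ⟨v⟩ : Nonempty (InfinitePlace K) := inferInstance
  have := coeffAbs_absInf_pos v F
  simp [ProjLift.coeffAbs, h, absInf] at this

/-- The height of a lift as a finite product of local absolute values. -/
theorem mulHeight_coeffs_eq (F : ProjLift K m M) {S : Finset (HeightOneSpectrum (𝓞 K))}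
    (hS : ∀ v ∉ S, F.coeffAbs (absFin v) = 1) :
    Height.mulHeight F.coeffs =
      (∏ v : InfinitePlace K, F.coeffAbs (absInf v) ^ v.mult) *
        ∏ v ∈ S, F.coeffAbs (absFin v) ^ localDegree v := by
  rw [NumberField.mulHeight_eq (coeffs_ne_zero F)]
  congr 1
  · refine Finset.prod_congr rfl fun v _ => ?_
    simp only [ProjLift.coeffAbs, absInf_algebraMap]
    rfl
  · rw [← finprod_comp_equiv (FinitePlace.equivHeightOneSpectrum (K := K)).symm]
    have : ∀ v : HeightOneSpectrum (𝓞 K),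
        (⨆ i, (FinitePlace.equivHeightOneSpectrum.symm v) (F.coeffs i)) =
          F.coeffAbs (absFin v) ^ localDegree v := fun v =>
      (coeffAbs_absFin_pow_localDegree v F).symm
    simp only [this]
    refine finprod_eq_prod_of_mulSupport_subset _ fun v hv => ?_
    by_contra hvS
    exact hv (by simp only [hS v hvS, one_pow])

theorem rpow_pow_swap {x : ℝ} (hx : 0 ≤ x) (n k : ℕ) (a b : ℝ) :
    (x ^ n) ^ ((k : ℝ) * (a * b)) = ((x ^ a) ^ b) ^ (n * k) := by
  rw [← Real.rpow_natCast x, ← Real.rpow_mul hx, ← Real.rpow_natCast _ (n * k), ← Real.rpow_mul hx,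
    ← Real.rpow_mul hx]
  congr 1
  push_cast
  ring

/-- The factor `n` in the exponent cancels the `n`-th root in the height, and the degree `d^i e`
splits the remaining root into the `d^i`-th root, which converges, and a fixed `e`-th root. -/
theorem height_rpow_eq {f : ProjMorphism K M M} {F : ProjLift K M M} (hF : f.IsLift F)
    {g : ProjMorphism K m M} {G : ProjLift K m M} (hG : g.IsLift G)
    {S : Finset (HeightOneSpectrum (𝓞 K))} (i : ℕ)
    (hS : ∀ v ∉ S, (F.comp^[i] G).coeffAbs (absFin v) = 1) :
    height (f.comp^[i] g) ^ ((Module.finrank ℚ K * (m + 1) : ℝ) / (f.comp^[i] g).deg) =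
      (∏ v : InfinitePlace K, (((F.comp^[i] G).coeffAbs (absInf v) ^ (1 / (F.deg : ℝ) ^ i)) ^
          (1 / (G.deg : ℝ))) ^ (v.mult * (m + 1))) *
        ∏ v ∈ S, (((F.comp^[i] G).coeffAbs (absFin v) ^ (1 / (F.deg : ℝ) ^ i)) ^
          (1 / (G.deg : ℝ))) ^ (localDegree v * (m + 1)) := by
  rw [← iterate_comp_equiv hF hG i]
  change (Height.mulHeight (F.comp^[i] G).coeffs ^ (1 / (Module.finrank ℚ K : ℝ))) ^
    ((Module.finrank ℚ K * (m + 1) : ℝ) / (F.comp^[i] G).deg) = _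
  have hinf : ∀ v : InfinitePlace K, 0 ≤ (F.comp^[i] G).coeffAbs (absInf v) := fun v =>
    (coeffAbs_absInf_pos v _).le
  have hfin : ∀ v : HeightOneSpectrum (𝓞 K), 0 ≤ (F.comp^[i] G).coeffAbs (absFin v) := fun v =>
    (coeffAbs_absFin_pos v _).le
  have hH := mulHeight_coeffs_eq (F.comp^[i] G) hS
  have h1 : 0 ≤ ∏ v : InfinitePlace K, (F.comp^[i] G).coeffAbs (absInf v) ^ v.mult :=
    Finset.prod_nonneg fun v _ => pow_nonneg (hinf v) _
  have h2 : 0 ≤ ∏ v ∈ S, (F.comp^[i] G).coeffAbs (absFin v) ^ localDegree v :=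
    Finset.prod_nonneg fun v _ => pow_nonneg (hfin v) _
  have hn : (Module.finrank ℚ K : ℝ) ≠ 0 :=
    Nat.cast_ne_zero.mpr (Module.finrank_pos (R := ℚ) (M := K)).ne'
  have hexp : 1 / (Module.finrank ℚ K : ℝ) *
      ((Module.finrank ℚ K * (m + 1) : ℝ) / (F.comp^[i] G).deg) =
      ((m + 1 : ℕ) : ℝ) * (1 / (F.deg : ℝ) ^ i * (1 / (G.deg : ℝ))) := by
    rw [ProjLift.iterate_comp_deg]
    push_cast
    rw [← mul_div_assoc, ← mul_assoc, one_div_mul_cancel hn, one_mul, one_div_mul_one_div,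
      mul_one_div]
  rw [← Real.rpow_mul (hH ▸ mul_nonneg h1 h2), hexp, hH, Real.mul_rpow h1 h2,
    ← Real.finsetProd_rpow _ _ fun v _ => pow_nonneg (hinf v) _,
    ← Real.finsetProd_rpow _ _ fun v _ => pow_nonneg (hfin v) _]
  congr 1
  · exact Finset.prod_congr rfl fun v _ => rpow_pow_swap (hinf v) _ _ _ _
  · exact Finset.prod_congr rfl fun v _ => rpow_pow_swap (hfin v) _ _ _ _

theorem localFactorInf_iterate {K : Type*} [Field K] {f : ProjMorphism K M M} {F : ProjLift K M M} (hF : f.IsLift F)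
    {g : ProjMorphism K m M} {G : ProjLift K m M} (hG : g.IsLift G) (v : InfinitePlace K) (i : ℕ) :
    localFactorInf v (f.comp^[i] g) = (muInf v m).real (domainInf v (F.comp^[i] G)) := by
  rw [← iterate_comp_equiv hF hG i]
  rfl

theorem localFactorFin_iterate {f : ProjMorphism K M M} {F : ProjLift K M M} (hF : f.IsLift F)
    {g : ProjMorphism K m M} {G : ProjLift K m M} (hG : g.IsLift G) (v : HeightOneSpectrum (𝓞 K))
    (i : ℕ) : localFactorFin v (f.comp^[i] g) = integralFin v (F.comp^[i] G) := by
  rw [← iterate_comp_equiv hF hG i]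
  rfl

/-- The finite set of primes at which `F` or `G` has bad reduction. -/
theorem exists_finset_hasGoodReduction (F : ProjLift K M M) (G : ProjLift K m M) :
    ∃ S : Finset (HeightOneSpectrum (𝓞 K)), ∀ v ∉ S,
      F.HasGoodReduction (absFinAbv v) ∧ G.HasGoodReduction (absFinAbv v) := by
  have h := (eventually_hasGoodReduction F).and (eventually_hasGoodReduction G)
  refine ⟨(Filter.eventually_cofinite.mp h).toFinset, fun v hv => ?_⟩
  rw [Set.Finite.mem_toFinset] at hv
  exact not_not.mp hv

theorem tendsto_globalConstant {f : ProjMorphism K M M} {F : ProjLift K M M} (hF : f.IsLift F)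
    (hd : 2 ≤ F.deg) {g : ProjMorphism K m M} {G : ProjLift K m M} (hG : g.IsLift G)
    (he : 1 ≤ G.deg) :
    Tendsto (fun i : ℕ => globalConstant (f.comp^[i] g)) atTop
      (𝓝 (fieldConstant K m *
          (∏ v : InfinitePlace K, (muInf v m).real (greenDomain v F G)) *
          ∏' v : HeightOneSpectrum (𝓞 K),
            ∫ z in (polydisc v m : Set (Fin (m + 1) → v.adicCompletion K)),
              greenIntegrand v F G z ∂(muFin v m))) := by
  obtain ⟨S, hS⟩ := exists_finset_hasGoodReduction F G
  -- The same `S` works for all `i`, so that limits may be taken factor by factor in finite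
  -- products.
  have hcoeff : ∀ i, ∀ v ∉ S, (F.comp^[i] G).coeffAbs (absFin v) = 1 := fun i v hv =>
    coeffAbs_eq_one_of_hasGoodReduction (absFinAbv_apply v) (isNonarchimedean_absFinAbv v)
      (hS v hv).1 (by omega) (hS v hv).2 he i
  have hfin : ∀ i, ∏' v : HeightOneSpectrum (𝓞 K), localFactorFin v (f.comp^[i] g) =
      ∏ v ∈ S, integralFin v (F.comp^[i] G) := fun i => by
    simp only [localFactorFin_iterate hF hG]
    exact tprod_eq_prod fun v hv => integralFin_eq_one v (hS v hv).1 hd (hS v hv).2 he i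
  rw [tprod_eq_prod (s := S) fun v hv =>
    integral_greenIntegrand_eq_one v (hS v hv).1 hd (hS v hv).2 he]
  set a : InfinitePlace K → ℝ := fun v =>
    (hatAbs (absInf v) F G ^ (1 / (G.deg : ℝ))) ^ (v.mult * (m + 1)) with ha
  set b : HeightOneSpectrum (𝓞 K) → ℝ := fun v =>
    (hatAbs (absFin v) F G ^ (1 / (G.deg : ℝ))) ^ (localDegree v * (m + 1)) with hb
  have hapos : ∀ v, 0 < a v := fun v =>
    pow_pos (Real.rpow_pos_of_pos (tendsto_hatAbs_inf v F hd G).1 _) _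
  have hbpos : ∀ v, 0 < b v := fun v =>
    pow_pos (Real.rpow_pos_of_pos (tendsto_hatAbs_fin v F hd G).1 _) _
  have hA : 0 < (∏ v, a v) * ∏ v ∈ S, b v :=
    mul_pos (Finset.prod_pos fun v _ => hapos v) (Finset.prod_pos fun v _ => hbpos v)
  have hheight : Tendsto (fun i => height (f.comp^[i] g) ^
      ((Module.finrank ℚ K * (m + 1) : ℝ) / (f.comp^[i] g).deg)) atTop
      (𝓝 ((∏ v, a v) * ∏ v ∈ S, b v)) := by
    simp only [fun i => height_rpow_eq hF hG i (hcoeff i)]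
    refine Tendsto.mul (tendsto_finsetProd _ fun v _ => ?_) (tendsto_finsetProd _ fun v _ => ?_)
    · have h := tendsto_hatAbs_inf v F hd G
      exact (h.2.rpow_const (Or.inl h.1.ne')).pow _
    · have h := tendsto_hatAbs_fin v F hd G
      exact (h.2.rpow_const (Or.inl h.1.ne')).pow _
  have hmain : Tendsto (fun i => globalConstant (f.comp^[i] g)) atTop
      (𝓝 (fieldConstant K m * (((∏ v : InfinitePlace K, (muInf v m).real (hatDomain v F G)) *
        ∏ v ∈ S, ∫ z in (polydisc v m : Set (Fin (m + 1) → v.adicCompletion K)),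
          hatIntegrand v F G z ∂(muFin v m)) / ((∏ v, a v) * ∏ v ∈ S, b v)))) := by
    simp only [globalConstant, hfin, localFactorInf_iterate hF hG]
    exact (((tendsto_finsetProd _ fun v _ => tendsto_muInf_domainInf v hd he).mul
      (tendsto_finsetProd _ fun v _ => tendsto_integralFin v F hd G he)).div hheight
        hA.ne').const_mul _
  convert! hmain using 2
  -- The factors `a v` and `b v` that separate the hat expressions from the Green expressions are
  -- those in the limit of the height, so they cancel.
  have h1 : ∏ v : InfinitePlace K, (muInf v m).real (hatDomain v F G) =
      (∏ v, a v) * ∏ v : InfinitePlace K, (muInf v m).real (greenDomain v F G) := by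
    rw [← Finset.prod_mul_distrib]
    exact Finset.prod_congr rfl fun v _ => muInf_real_hatDomain v hd he
  have h2 : ∏ v ∈ S, ∫ z in (polydisc v m : Set (Fin (m + 1) → v.adicCompletion K)),
      hatIntegrand v F G z ∂(muFin v m) = (∏ v ∈ S, b v) *
        ∏ v ∈ S, ∫ z in (polydisc v m : Set (Fin (m + 1) → v.adicCompletion K)),
          greenIntegrand v F G z ∂(muFin v m) := by
    rw [← Finset.prod_mul_distrib]
    refine Finset.prod_congr rfl fun v _ => ?_
    simp only [hatIntegrand_eq_mul]
    rw [integral_const_mul]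
  rw [h1, h2, mul_mul_mul_comm, mul_div_cancel_left₀ _ hA.ne', mul_assoc]

end Global

end DynSchanuel

theorem proposition2p11 {K : Type*} [Field K] [NumberField K] {m M : ℕ} (hm : 1 ≤ m)
    (f : ProjMorphism K M M) (hf : 2 ≤ f.deg) (F : ProjLift K M M) (hF : f.IsLift F)
    (g : ProjMorphism K m M) (hg : 1 ≤ g.deg) (G : ProjLift K m M) (hG : g.IsLift G) :
    -- the limits that define the Green's functions and `|F̂ ∘ G|_v` exist
    ((∀ v : InfinitePlace K,
        (∀ x : Fin (M + 1) → v.Completion, x ≠ 0 →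
          Tendsto (fun i : ℕ => Real.log (tupleAbs (absInf v) (F.eval^[i] x)) / (F.deg : ℝ) ^ i)
            atTop (𝓝 (green (absInf v) F x))) ∧
        Tendsto (fun i : ℕ => (F.comp^[i] G).coeffAbs (absInf v) ^ (1 / (F.deg : ℝ) ^ i))
          atTop (𝓝 (hatAbs (absInf v) F G))) ∧
      (∀ v : HeightOneSpectrum (𝓞 K),
        (∀ x : Fin (M + 1) → v.adicCompletion K, x ≠ 0 →
          Tendsto (fun i : ℕ => Real.log (tupleAbs (absFin v) (F.eval^[i] x)) / (F.deg : ℝ) ^ i)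
            atTop (𝓝 (green (absFin v) F x))) ∧
        Tendsto (fun i : ℕ => (F.comp^[i] G).coeffAbs (absFin v) ^ (1 / (F.deg : ℝ) ^ i))
          atTop (𝓝 (hatAbs (absFin v) F G)))) ∧
    -- the volumes are finite, the integrals and the infinite product converge
    ((∀ v : InfinitePlace K,
        muInf v m (greenDomain v F G) ≠ ⊤ ∧ muInf v m (hatDomain v F G) ≠ ⊤) ∧
      (∀ v : HeightOneSpectrum (𝓞 K),
        IntegrableOn (greenIntegrand v F G) (polydisc v m) (muFin v m) ∧
        IntegrableOn (hatIntegrand v F G) (polydisc v m) (muFin v m)) ∧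
      Multipliable fun v : HeightOneSpectrum (𝓞 K) =>
        ∫ z in (polydisc v m : Set (Fin (m + 1) → v.adicCompletion K)),
          greenIntegrand v F G z ∂(muFin v m)) ∧
    -- the global formula
    (Tendsto (fun i : ℕ => globalConstant (f.comp^[i] g)) atTop (𝓝 (hatConstant f g)) ∧
      hatConstant f g =
        fieldConstant K m *
          (∏ v : InfinitePlace K, (muInf v m).real (greenDomain v F G)) *
          ∏' v : HeightOneSpectrum (𝓞 K),
            ∫ z in (polydisc v m : Set (Fin (m + 1) → v.adicCompletion K)),
              greenIntegrand v F G z ∂(muFin v m)) ∧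
    -- convergence of the local factors
    (∀ v : InfinitePlace K,
      Tendsto (fun i : ℕ => localFactorInf v (f.comp^[i] g)) atTop
        (𝓝 ((muInf v m).real (hatDomain v F G)))) ∧
    (∀ v : HeightOneSpectrum (𝓞 K),
      Tendsto (fun i : ℕ => localFactorFin v (f.comp^[i] g)) atTop
        (𝓝 (∫ z in (polydisc v m : Set (Fin (m + 1) → v.adicCompletion K)),
          hatIntegrand v F G z ∂(muFin v m)))) := by
  obtain rfl : Quotient.mk _ F = f := hF
  obtain rfl : Quotient.mk _ G = g := hG
  have hd : 2 ≤ F.deg := hf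
  have he : 1 ≤ G.deg := hg
  have hlim := tendsto_globalConstant (f := Quotient.mk _ F) (F := F) rfl hd
    (g := Quotient.mk _ G) (G := G) rfl he
  have hhat : hatConstant (Quotient.mk _ F) (Quotient.mk _ G) = _ := hlim.limUnder_eq
  refine ⟨⟨fun v => ⟨fun x hx => ?_, (tendsto_hatAbs_inf v F hd G).2⟩,
    fun v => ⟨fun x hx => ?_, (tendsto_hatAbs_fin v F hd G).2⟩⟩, ⟨fun v => ⟨?_, ?_⟩, fun v =>
    ⟨integrableOn_greenIntegrand v F hd G he, integrableOn_hatIntegrand v F hd G he⟩, ?_⟩,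
    ⟨hhat ▸ hlim, hhat⟩, fun v => ?_, fun v => ?_⟩
  · obtain ⟨B, hB⟩ := (isPowNorm_absInf v).exists_green_bound (eq_zero_of_absInf_eq_zero v) F hd
    exact (hB x hx).1
  · obtain ⟨B, hB⟩ := (isPowNorm_absFin v).exists_green_bound (eq_zero_of_absFin_eq_zero v) F hd
    exact (hB x hx).1
  · exact (muInf_greenDomain_lt_top v hd he).ne
  · rw [muInf_hatDomain v hd]
    exact (muInf_greenSublevel_lt_top v hd he _).ne
  · obtain ⟨S, hS⟩ := exists_finset_hasGoodReduction F G
    exact multipliable_of_ne_finset_one (s := S) fun v hv =>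
      integral_greenIntegrand_eq_one v (hS v hv).1 hd (hS v hv).2 he
  · simp only [localFactorInf_iterate (f := Quotient.mk _ F) (F := F) rfl
      (g := Quotient.mk _ G) (G := G) rfl]
    exact tendsto_muInf_domainInf v hd he
  · simp only [localFactorFin_iterate (f := Quotient.mk _ F) (F := F) rfl
      (g := Quotient.mk _ G) (G := G) rfl]
    exact tendsto_integralFin v F hd G he
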